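/- All graphs are finite, simple and have at least one vertex. For a graph $G$ write $N[v]$ for the closed neighbourhood of $v$. A *legal dominating sequence* of $G$ is a sequence $(v_1,\dots,v_k)$ of distinct vertices such that $\{v_1,\dots,v_k\}$ is a dominating set and $N[v_i]\setminus\bigcup_{j<i}N[v_j]\neq\emptyset$ for every $i$. A *Grundy dominating sequence* (Gds) is a legal dominating sequence of maximum length, and $\gamma_{gr}(G)$ is that length. For a graph $G$ and a family $\mathcal R=\{G_v : v\in V(G)\}$ of graphs, the $X$-join product $G\hookleftarrow\mathcal R$ is obtained by replacing each vertex $v$ of $G$ by $G_v$, joining all vertices of $G_u$ to all vertices of $G_v$ whenever $uv\in E(G)$. For a weight vector $w$ on $V(G)$, $\alpha_w(G)$ is the maximum of $\sum_{v\in I}w_v$ over all independent sets $I$ of $G$ (the empty set included). Let $m\ge 1$ and $n\ge m+2$, let $G=P_n^m$ be the $m$-th power of the path on the vertices $1,2,\dots,n$ (two distinct vertices are adjacent if their distance in the path is at most $m$), and let $\mathcal R=\{G_i : 1\le i\le n\}$ be any family of graphs. Define $w\in\mathbb Z^n$ as follows. If $n>2m+2$, $$w_i=\begin{cases}\gamma_{gr}(G_i)-i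 & \text{if } 1\le i\le m+1,\\ \gamma_{gr}(G_i)-(m+1) & \text{if } m+2\le i\le n-m-1,\\ \gamma_{gr}(G_i)-(m+1)+i & \text{if } n-m\le i\le n.\end{cases}$$ If $n\le 2m+2$, $$w_i=\begin{cases}\gamma_{gr}(G_i)-i & \text{if } 1\le i\le n-m-1,\\ \gamma_{gr}(G_i) & \text{if } n-m-1<i<m+2,\\ \gamma_{gr}(G_i)+i-(m+1) & \text{if } m+2\le i\le n.\end{cases}$$ Then, in both cases, $\gamma_{gr}(G\hookleftarrow\mathcal R)=\alpha_w(P_n^m)$. Moreover, there is an algorithm which, given $n$, $m$ and a Gds $S_i$ of $G_i$ for every $i\in\{1,\dots,n\}$, outputs a Gds of $G\hookleftarrow\mathcal R$ in linear time: on a random access machine with unit-cost addition, subtraction, comparison and indirect addressing, where the vertices of $G\hookleftarrow\mathcal R$ are named by machine words, it makes $O(N)$ steps, with $N=2+n+\sum_{i=1}^n|S_i|$ the number of words of the input, and uses only numbers that are $O(N)$ or at most as large as the largest vertex name in the input. -/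

import Mathlib

universe u

section Graphs

variable {V : Type u}

/-- The closed neighbourhood `N[v]`. -/
def SimpleGraph.closedNbhd (G : SimpleGraph V) (v : V) : Set V :=
  insert v (G.neighborSet v)

/-- The private neighbourhood of the `i`-th entry of the sequence `S` with respect to `S`:
its closed neighbourhood minus the closed neighbourhoods of all earlier entries. -/
def SimpleGraph.privateNbhd (G : SimpleGraph V) (S : List V) (i : Fin S.length) : Set V :=
  G.closedNbhd (S.get i) \ ⋃ j : Fin S.length, ⋃ _ : j < i, G.closedNbhd (S.get j)

/-- `S` is a legal dominating sequence of `G`: its entries are distinct, they form a dominating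
set, and every entry has a nonempty private neighbourhood. -/
def SimpleGraph.IsLegalDomSeq (G : SimpleGraph V) (S : List V) : Prop :=
  S.Nodup ∧ (∀ v, ∃ u ∈ S, u ∈ G.closedNbhd v) ∧
    ∀ i : Fin S.length, (G.privateNbhd S i).Nonempty

/-- `S` is a Grundy dominating sequence (Gds): a legal dominating sequence of maximum length. -/
def SimpleGraph.IsGds (G : SimpleGraph V) (S : List V) : Prop :=
  G.IsLegalDomSeq S ∧ ∀ T, G.IsLegalDomSeq T → T.length ≤ S.length

/-- The Grundy domination number: the maximum length of a legal dominating sequence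
(used for finite graphs only, where these lengths are bounded by the order of the graph). -/
noncomputable def SimpleGraph.grundyDomNumber (G : SimpleGraph V) : ℕ :=
  sSup {k | ∃ S, G.IsLegalDomSeq S ∧ S.length = k}

/-- The X-join product: every vertex `i` of `G` is replaced by the graph `R i`. -/
def SimpleGraph.xJoin {I : Type*} (G : SimpleGraph I) {W : I → Type u}
    (R : ∀ i, SimpleGraph (W i)) : SimpleGraph (Σ i, W i) where
  Adj x y := G.Adj x.1 y.1 ∨ ∃ (i : I) (a b : W i), (R i).Adj a b ∧ x = ⟨i, a⟩ ∧ y = ⟨i, b⟩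
  symm := ⟨by
    rintro x y (h | ⟨i, a, b, h, hx, hy⟩)
    · exact Or.inl h.symm
    · exact Or.inr ⟨i, b, a, h.symm, hy, hx⟩⟩
  loopless := ⟨by
    rintro x (h | ⟨i, a, b, h, rfl, hy⟩)
    · exact G.loopless.irrefl _ h
    · cases hy
      exact (R i).loopless.irrefl _ h⟩

/-- The `m`-th power of `G`: distinct vertices at distance at most `m` in `G` are adjacent. -/
def SimpleGraph.power (G : SimpleGraph V) (m : ℕ) : SimpleGraph V where
  Adj a b := a ≠ b ∧ G.edist a b ≤ m
  symm := ⟨fun _ _ h => ⟨h.1.symm, by rw [SimpleGraph.edist_comm]; exact h.2⟩⟩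
  loopless := ⟨fun _ h => h.1 rfl⟩

open Classical in
/-- The maximum weight of an independent set (the empty set included). -/
noncomputable def SimpleGraph.maxWeightIndep [Fintype V] (G : SimpleGraph V) (w : V → ℤ) : ℤ :=
  (Finset.univ.filter fun s : Finset V => G.IsIndepSet (s : Set V)).sup'
    ⟨∅, by simp⟩ fun s => ∑ v ∈ s, w v

end Graphs

/-- The power of a path `P_n^m`; the vertex `i : Fin n` is the `(i + 1)`-st vertex of the path. -/
def pathPower (n m : ℕ) : SimpleGraph (Fin n) :=
  (SimpleGraph.pathGraph n).power m

/-- The weights in the case `n > 2 m + 2`, in terms of `g i = γ_gr (G_i)`. With `k = i + 1`, the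
three cases are `k ∈ [1, m + 1]`, `k ∈ [m + 2, n - m - 1]` and `k ∈ [n - m, n]`. -/
def longPathWeight (n m : ℕ) (g : Fin n → ℕ) (i : Fin n) : ℤ :=
  let k : ℕ := i + 1
  if k ≤ m + 1 then (g i : ℤ) - k
  else if k + m + 1 ≤ n then (g i : ℤ) - (1 + m)
  else (g i : ℤ) - (1 + m) + k

/-- The weights in the case `n ≤ 2 m + 2`, in terms of `g i = γ_gr (G_i)`. With `k = i + 1`, the
three cases are `k ∈ [1, n - m - 1]`, `n - m - 1 < k < m + 2` and `k ∈ [m + 2, n]`. -/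
def shortPathWeight (n m : ℕ) (g : Fin n → ℕ) (i : Fin n) : ℤ :=
  let k : ℕ := i + 1
  if k + m + 1 ≤ n then (g i : ℤ) - k
  else if k < m + 2 then (g i : ℤ)
  else (g i : ℤ) + k - (1 + m)

namespace RAM

/-! A random access machine on natural-number words, with registers, a memory with indirect
addressing, and structured control flow. Every elementary operation and every test costs one
step. Only addition and truncated subtraction are available as arithmetic, and (in `Exec`)
every number that is produced has to fit into the word size `W`. -/

/-- A configuration: contents of the registers and of the memory cells. -/
structure State where
  reg : ℕ → ℕ
  mem : ℕ → ℕ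

/-- Elementary operations; `d`, `a`, `b` are indices of registers. -/
inductive Op where
  | const (d c : ℕ)
  | move (d a : ℕ)
  | add (d a b : ℕ)
  | sub (d a b : ℕ)
  | load (d a : ℕ)
  | store (a b : ℕ)

/-- The effect of an elementary operation. -/
def Op.run : Op → State → State
  | .const d c, s => { s with reg := Function.update s.reg d c }
  | .move d a, s => { s with reg := Function.update s.reg d (s.reg a) }
  | .add d a b, s => { s with reg := Function.update s.reg d (s.reg a + s.reg b) }
  | .sub d a b, s => { s with reg := Function.update s.reg d (s.reg a - s.reg b) }
  | .load d a, s => { s with reg := Function.update s.reg d (s.mem (s.reg a)) }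
  | .store a b, s => { s with mem := Function.update s.mem (s.reg a) (s.reg b) }

/-- The operation does not overflow words with values below `W`. -/
def Op.Fits (W : ℕ) : Op → State → Prop
  | .const _ c, _ => c < W
  | .add _ a b, s => s.reg a + s.reg b < W
  | _, _ => True

/-- Programs. The tests are of the form "register `a` holds less than register `b`". -/
inductive Prog where
  | skip
  | op (o : Op)
  | seq (p q : Prog)
  | ifLt (a b : ℕ) (p q : Prog)
  | whileLt (a b : ℕ) (p : Prog)

/-- `Exec W p s t s'`: with word size `W`, the program `p` started in `s` halts in `s'` after
exactly `t` steps, without any overflow. -/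
inductive Exec (W : ℕ) : Prog → State → ℕ → State → Prop where
  | skip (s : State) : Exec W .skip s 1 s
  | op (o : Op) (s : State) (h : o.Fits W s) : Exec W (.op o) s 1 (o.run s)
  | seq {p q : Prog} {s s' s'' : State} {t t' : ℕ} (h : Exec W p s t s')
      (h' : Exec W q s' t' s'') : Exec W (.seq p q) s (t + t') s''
  | ifTrue {a b : ℕ} {p q : Prog} {s s' : State} {t : ℕ} (hlt : s.reg a < s.reg b)
      (h : Exec W p s t s') : Exec W (.ifLt a b p q) s (1 + t) s'
  | ifFalse {a b : ℕ} {p q : Prog} {s s' : State} {t : ℕ} (hge : ¬ s.reg a < s.reg b)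
      (h : Exec W q s t s') : Exec W (.ifLt a b p q) s (1 + t) s'
  | whileTrue {a b : ℕ} {p : Prog} {s s' s'' : State} {t t' : ℕ} (hlt : s.reg a < s.reg b)
      (h : Exec W p s t s') (h' : Exec W (.whileLt a b p) s' t' s'') :
      Exec W (.whileLt a b p) s (1 + t + t') s''
  | whileFalse {a b : ℕ} {p : Prog} {s : State} (hge : ¬ s.reg a < s.reg b) :
      Exec W (.whileLt a b p) s 1 s

/-- The initial configuration: the input occupies the first memory cells, everything else is 0. -/
def initial (input : List ℕ) : State where
  reg := fun _ => 0
  mem := fun a => input.getD a 0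

/-- The output: on halting, register 0 holds the address of its first word, register 1 its
length. -/
def State.output (s : State) : List ℕ :=
  (List.range (s.reg 1)).map fun k => s.mem (s.reg 0 + k)

end RAM

/-- The input for `n`, `m` and a family of `n` lists of words: `n`, `m`, and then the lists one
after the other, each preceded by its length. -/
def encodeInput (n m : ℕ) (L : Fin n → List ℕ) : List ℕ :=
  n :: m :: (List.ofFn fun i => (L i).length :: L i).flatten

/-! Call an entry's footprint a vertex that it dominates first. A legal sequence of maximum length
dominates automatically, so only legality matters.

For the upper bound, cover the edges of `P_n^m` by the `n - m` windows `{x, …, x + m}`, which are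
cliques. Given a legal sequence of the product, let `I` be the set of fibres entered while no
neighbouring fibre has been touched; it is independent. An entry in such a fibre `i` at a time when
no neighbour is touched extends a legal sequence of `G_i`. Any other entry has its footprint in a
different fibre `k`, no neighbour of which has been touched: if `k` is in `I`, the footprint itself
extends the legal sequence of `G_k`; otherwise the entry is charged to a window through both fibres,
which is hit for the first time. All windows through `i ∈ I` are hit first by `i` and receive no
charge. Hence the length is at most `n - m + ∑_{i ∈ I} (γ_gr(G_i) - c_i)`, where `c_i` is the number
of windows through `i` (`IsLegal.exists_indep_aux`).

The bound is attained: run through the fibres from right to left, write a whole Gds in each fibre of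
an optimal `I`, and for each window `{k, …, k + m}` missing `I` one vertex of fibre `k + m`, with
footprint in fibre `k` (`length_traceSeq`, `isLegal_traceSeq`). An optimal `I` comes from the
recursion `optValue`.

The constant `n - m` is absorbed by adding it to the weights of the last `m + 1` vertices. They form
a clique, so it is counted at most once; an independent set missing them can take in vertex `n`, at
no loss because `c_n = 1 ≤ γ_gr(G_n)`. This gives the stated weights. The algorithm tabulates
`optValue` and traces it back, at cost `O(|S_k| + 1)` for each fibre. -/

namespace SimpleGraph

/-! ### Legal sequences without the domination requirement -/

variable {V : Type u} {G : SimpleGraph V}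

theorem mem_closedNbhd {u v : V} : u ∈ G.closedNbhd v ↔ u = v ∨ G.Adj v u := by
  simp [closedNbhd]

theorem mem_closedNbhd_comm {u v : V} : u ∈ G.closedNbhd v ↔ v ∈ G.closedNbhd u := by
  rw [mem_closedNbhd, mem_closedNbhd, eq_comm, G.adj_comm]

theorem self_mem_closedNbhd (v : V) : v ∈ G.closedNbhd v := by
  simp [closedNbhd]

/-- Every entry of `S` has a closed neighbour that no earlier entry dominates. -/
def IsLegal (G : SimpleGraph V) (S : List V) : Prop :=
  ∀ (pre : List V) (x : V), pre ++ [x] <+: S → ∃ y ∈ G.closedNbhd x, ∀ z ∈ pre, y ∉ G.closedNbhd z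

theorem isLegal_nil : G.IsLegal [] := by
  intro pre x h
  simp at h

theorem IsLegal.of_append {S B : List V} (h : G.IsLegal (S ++ B)) : G.IsLegal S :=
  fun pre x hp => h pre x (hp.trans (List.prefix_append S B))

theorem isLegal_concat {S : List V} {x : V} :
    G.IsLegal (S ++ [x]) ↔
      G.IsLegal S ∧ ∃ y ∈ G.closedNbhd x, ∀ z ∈ S, y ∉ G.closedNbhd z := by
  refine ⟨fun h => ⟨h.of_append, h S x List.prefix_rfl⟩, fun ⟨h, h'⟩ pre z hp => ?_⟩
  rcases List.prefix_concat_iff.1 hp with hp | hp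
  · obtain ⟨rfl, hx⟩ := List.append_inj' hp rfl
    obtain rfl : z = x := by simpa using hx
    exact h'
  · exact h pre z hp

theorem IsLegal.nodup {S : List V} (h : G.IsLegal S) : S.Nodup := by
  induction S using List.reverseRecOn with
  | nil => exact List.nodup_nil
  | append_singleton S x ih =>
    obtain ⟨hS, y, hy, h'⟩ := isLegal_concat.1 h
    refine List.nodup_append'.2 ⟨ih hS, List.nodup_singleton x, ?_⟩
    rw [List.disjoint_singleton]
    exact fun hx => h' x hx hy

theorem isLegal_iff_privateNbhd {S : List V} :
    G.IsLegal S ↔ ∀ i : Fin S.length, (G.privateNbhd S i).Nonempty := by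
  constructor
  · intro h i
    obtain ⟨y, hy, h'⟩ := h (S.take i) (S.get i) (by
      have : S.take i ++ [S.get i] = S.take (i + 1) := by simp
      rw [this]
      exact List.take_prefix _ _)
    refine ⟨y, hy, ?_⟩
    simp only [Set.mem_iUnion, not_exists]
    intro j hj
    refine h' _ ?_
    rw [List.mem_take_iff_getElem]
    exact ⟨j, by have := j.2; simp; omega, rfl⟩
  · rintro h pre x ⟨suf, rfl⟩
    have hlen : pre.length < (pre ++ [x] ++ suf).length := by simp
    obtain ⟨y, hy, h'⟩ := h ⟨pre.length, hlen⟩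
    refine ⟨y, by simpa using hy, fun z hz hyz => h' ?_⟩
    obtain ⟨j, hj, rfl⟩ := List.getElem_of_mem hz
    simp only [Set.mem_iUnion]
    refine ⟨⟨j, by omega⟩, by simpa using hj, ?_⟩
    simpa [List.getElem_append_left, hj] using hyz

theorem isLegalDomSeq_iff {S : List V} :
    G.IsLegalDomSeq S ↔ G.IsLegal S ∧ ∀ v, ∃ u ∈ S, v ∈ G.closedNbhd u := by
  simp only [IsLegalDomSeq, ← isLegal_iff_privateNbhd]
  constructor
  · rintro ⟨-, h, h'⟩
    exact ⟨h', fun v => (h v).imp fun u hu => ⟨hu.1, mem_closedNbhd_comm.1 hu.2⟩⟩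
  · rintro ⟨h, h'⟩
    exact ⟨h.nodup, fun v => (h' v).imp fun u hu => ⟨hu.1, mem_closedNbhd_comm.1 hu.2⟩, h⟩

/-- A legal sequence of maximum length is a Grundy dominating sequence, and its length is the
Grundy domination number. -/
theorem IsLegal.isGds_of_forall_length_le {S : List V} (hS : G.IsLegal S)
    (hmax : ∀ T, G.IsLegal T → T.length ≤ S.length) :
    G.IsGds S ∧ G.grundyDomNumber = S.length := by
  have hdom : G.IsLegalDomSeq S := by
    -- An undominated vertex could be appended with itself as footprint, contradicting maximality.
    refine isLegalDomSeq_iff.2 ⟨hS, ?_⟩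
    by_contra! h
    obtain ⟨v, hv⟩ := h
    have := hmax (S ++ [v]) (isLegal_concat.2 ⟨hS, v, self_mem_closedNbhd v, hv⟩)
    simp at this
  have hle : ∀ T, G.IsLegalDomSeq T → T.length ≤ S.length :=
    fun T hT => hmax T (isLegalDomSeq_iff.1 hT).1
  refine ⟨⟨hdom, hle⟩, IsGreatest.csSup_eq ⟨⟨S, hdom, rfl⟩, ?_⟩⟩
  rintro _ ⟨T, hT, rfl⟩
  exact hle T hT

theorem exists_isLegal_forall_length_le [Fintype V] (G : SimpleGraph V) :
    ∃ S, G.IsLegal S ∧ ∀ T, G.IsLegal T → T.length ≤ S.length := by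
  obtain ⟨k, ⟨S, hS, rfl⟩, hk⟩ := BddAbove.exists_isGreatest_of_nonempty
    (S := {k | ∃ S, G.IsLegal S ∧ S.length = k})
    ⟨Fintype.card V, by rintro _ ⟨T, hT, rfl⟩; exact hT.nodup.length_le_card⟩
    ⟨0, [], isLegal_nil, rfl⟩
  exact ⟨S, hS, fun T hT => hk ⟨T, hT, rfl⟩⟩

theorem exists_isGds [Fintype V] (G : SimpleGraph V) : ∃ S, G.IsGds S := by
  obtain ⟨S, hS, hmax⟩ := G.exists_isLegal_forall_length_le
  exact ⟨S, (hS.isGds_of_forall_length_le hmax).1⟩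

theorem IsLegal.length_le_grundyDomNumber [Fintype V] {T : List V} (hT : G.IsLegal T) :
    T.length ≤ G.grundyDomNumber := by
  obtain ⟨S, hS, hmax⟩ := G.exists_isLegal_forall_length_le
  rw [(hS.isGds_of_forall_length_le hmax).2]
  exact hmax T hT

theorem IsGds.isLegal {S : List V} (h : G.IsGds S) : G.IsLegal S :=
  (isLegalDomSeq_iff.1 h.1).1

theorem IsGds.length_eq [Fintype V] {S : List V} (h : G.IsGds S) :
    S.length = G.grundyDomNumber := by
  obtain ⟨T, hT, hmax⟩ := G.exists_isLegal_forall_length_le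
  obtain ⟨hT', hlen⟩ := hT.isGds_of_forall_length_le hmax
  rw [hlen]
  exact le_antisymm (hmax S h.isLegal) (h.2 T hT'.1)

theorem IsGds.ne_nil [Nonempty V] {S : List V} (h : G.IsGds S) : S ≠ [] := by
  obtain ⟨u, hu, -⟩ := (isLegalDomSeq_iff.1 h.1).2 (Classical.arbitrary V)
  exact List.ne_nil_of_mem hu

theorem grundyDomNumber_pos [Fintype V] [Nonempty V] (G : SimpleGraph V) :
    0 < G.grundyDomNumber := by
  obtain ⟨S, hS⟩ := G.exists_isGds
  rw [← hS.length_eq]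
  exact List.length_pos_iff.2 hS.ne_nil

end SimpleGraph

/-! ### Upper bound for join products from an edge clique cover -/

namespace SimpleGraph

section XJoin

variable {ι : Type*} {G : SimpleGraph ι} {V : ι → Type u} {R : ∀ i, SimpleGraph (V i)}

theorem mem_closedNbhd_xJoin_same {i : ι} {a b : V i} :
    (⟨i, b⟩ : Σ i, V i) ∈ (G.xJoin R).closedNbhd ⟨i, a⟩ ↔ b ∈ (R i).closedNbhd a := by
  rw [mem_closedNbhd, mem_closedNbhd]
  constructor
  · rintro (h | h | ⟨j, a', b', h, h1, h2⟩)
    · exact Or.inl (eq_of_heq (Sigma.mk.inj h).2)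
    · exact absurd h (G.loopless.irrefl _)
    · cases h1
      cases h2
      exact Or.inr h
  · rintro (rfl | h)
    exacts [Or.inl rfl, Or.inr (Or.inr ⟨i, a, b, h, rfl, rfl⟩)]

/-- Between different fibres only the indices matter, so a single entry dominates every neighbouring
fibre entirely. -/
theorem mem_closedNbhd_xJoin_of_ne {x y : Σ i, V i} (h : x.1 ≠ y.1) :
    y ∈ (G.xJoin R).closedNbhd x ↔ G.Adj x.1 y.1 := by
  rw [mem_closedNbhd]
  constructor
  · rintro (rfl | h' | ⟨j, a', b', h', rfl, rfl⟩)
    exacts [absurd rfl h, h', absurd rfl h]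
  · exact fun h' => Or.inr (Or.inl h')

theorem mem_closedNbhd_xJoin_of_adj {x y : Σ i, V i} (h : G.Adj x.1 y.1) :
    y ∈ (G.xJoin R).closedNbhd x :=
  mem_closedNbhd.2 (Or.inr (Or.inl h))

open Classical in
/-- The fibres in which a legal sequence of the product starts before any neighbouring fibre is
touched form an independent set `I`. The entries outside these fibres are charged to members of
an edge clique cover `Q` that avoid `I`, up to a legal sequence `A i` for each `i ∈ I`. -/
theorem IsLegal.exists_indep_aux {κ : Type*} {Q : Finset κ} {C : κ → Set ι}
    (hC : ∀ x ∈ Q, G.IsClique (C x)) (hE : ∀ i j, G.Adj i j → ∃ x ∈ Q, i ∈ C x ∧ j ∈ C x)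
    {T : List (Σ i, V i)} (hT : (G.xJoin R).IsLegal T) :
    ∃ (I : Finset ι) (A : ∀ i, List (V i)) (q : ℕ),
      G.IsIndepSet (I : Set ι) ∧ (∀ i ∈ I, ∃ z ∈ T, z.1 = i) ∧ (∀ i, (R i).IsLegal (A i)) ∧
      (∀ i, (∀ z ∈ T, ¬ G.Adj z.1 i) → (∃ z ∈ T, z.1 = i) → i ∈ I) ∧
      (∀ i, (∀ z ∈ T, ¬ G.Adj z.1 i) → ∀ a, (⟨i, a⟩ : Σ i, V i) ∈ T ↔ a ∈ A i) ∧
      T.length ≤ ∑ i ∈ I, (A i).length + q ∧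
      q + ∑ i ∈ I, (Q.filter fun x => i ∈ C x).card ≤
        (Q.filter fun x => ∃ z ∈ T, z.1 ∈ C x).card := by
  induction T using List.reverseRecOn with
  | nil => exact ⟨∅, fun _ => [], 0, by simp, by simp, fun _ => isLegal_nil, by simp, by simp,
      by simp, by simp⟩
  | append_singleton T x ih =>
    obtain ⟨hT, ⟨k, b⟩, hy, hnew⟩ := isLegal_concat.1 hT
    obtain ⟨I, A, q, hI, hIT, hA, hstart, hmem, hlen, hq⟩ := ih hT
    obtain ⟨i, a⟩ := x
    have hmono : (Q.filter fun x => ∃ z ∈ T, z.1 ∈ C x) ⊆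
        Q.filter fun x => ∃ z ∈ T ++ [⟨i, a⟩], z.1 ∈ C x := by
      intro x hx
      simp only [Finset.mem_filter] at hx ⊢
      obtain ⟨hx, z, hz, hzx⟩ := hx
      exact ⟨hx, z, List.mem_append_left _ hz, hzx⟩
    have hnb : ∀ j, (∀ z ∈ T ++ [⟨i, a⟩], ¬ G.Adj z.1 j) →
        (∀ z ∈ T, ¬ G.Adj z.1 j) ∧ ¬ G.Adj i j := fun j h =>
      ⟨fun z hz => h z (List.mem_append_left _ hz), h ⟨i, a⟩ (by simp)⟩
    -- If no neighbour of fibre `i` is touched, the new entry goes to `A i`.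
    by_cases hn : ∀ z ∈ T, ¬ G.Adj z.1 i
    · have hA' : (R i).IsLegal (A i ++ [a]) := by
        refine isLegal_concat.2 ⟨hA i, ?_⟩
        -- For `i ∈ I` the fibre already has an entry, which dominates all neighbouring fibres; the
        -- footprint must therefore lie in fibre `i`. For `i ∉ I` the fibre is still empty.
        by_cases hi : i ∈ I
        · obtain ⟨z, hz, rfl⟩ := hIT i hi
          have hk : k = z.1 := by
            by_contra hk
            refine hnew z hz (mem_closedNbhd_xJoin_of_adj ?_)
            exact (mem_closedNbhd_xJoin_of_ne (y := ⟨k, b⟩) (x := ⟨z.1, a⟩) (Ne.symm hk)).1 hy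
          subst hk
          refine ⟨b, mem_closedNbhd_xJoin_same.1 hy, fun a' ha' hb => ?_⟩
          exact hnew _ ((hmem _ hn a').2 ha') (mem_closedNbhd_xJoin_same.2 hb)
        · refine ⟨a, self_mem_closedNbhd a, fun a' ha' => ?_⟩
          exact absurd (hstart i hn ⟨_, (hmem i hn a').2 ha', rfl⟩) hi
      refine ⟨insert i I, Function.update A i (A i ++ [a]), q, ?_, ?_, ?_, ?_, ?_, ?_, ?_⟩
      · rw [Finset.coe_insert]
        refine Set.pairwise_insert.2 ⟨hI, fun j hj _ => ?_⟩
        obtain ⟨z, hz, rfl⟩ := hIT j hj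
        exact ⟨fun h => hn z hz h.symm, hn z hz⟩
      · intro j hj
        rcases Finset.mem_insert.1 hj with rfl | hj
        · exact ⟨_, List.mem_append_right _ (List.mem_singleton_self _), rfl⟩
        · obtain ⟨z, hz, h⟩ := hIT j hj
          exact ⟨z, List.mem_append_left _ hz, h⟩
      · intro j
        rcases eq_or_ne j i with rfl | hj
        · simpa using hA'
        · simpa [hj] using hA j
      · rintro j hj ⟨z, hz, rfl⟩
        rcases List.mem_append.1 hz with hz | hz
        · exact Finset.mem_insert_of_mem (hstart _ (hnb _ hj).1 ⟨z, hz, rfl⟩)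
        · simp [List.mem_singleton.1 hz]
      · intro j hj a'
        rw [List.mem_append, hmem j (hnb _ hj).1]
        rcases eq_or_ne j i with rfl | hji
        · simp
        · simp [hji]
      · by_cases hi : i ∈ I
        · rw [Finset.insert_eq_of_mem hi, ← Finset.add_sum_erase _ _ hi]
          rw [← Finset.add_sum_erase _ _ hi] at hlen
          rw [Finset.sum_congr rfl (g := fun j => (A j).length) fun j hj => by
            rw [Function.update_of_ne (Finset.ne_of_mem_erase hj)]]
          simp
          omega
        · rw [Finset.sum_insert hi, Finset.sum_congr rfl (g := fun j => (A j).length) fun j hj => by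
            rw [Function.update_of_ne (ne_of_mem_of_not_mem hj hi)]]
          simp
          omega
      · by_cases hi : i ∈ I
        · rw [Finset.insert_eq_of_mem hi]
          exact hq.trans (Finset.card_le_card hmono)
        · rw [Finset.sum_insert hi]
          -- No clique through a newly entered `i` has been hit: an earlier hit would lie in a
          -- neighbouring fibre or in fibre `i` itself.
          have hdisj : Disjoint (Q.filter fun x => ∃ z ∈ T, z.1 ∈ C x)
              (Q.filter fun x => i ∈ C x) := by
            refine Finset.disjoint_filter.2 ?_
            rintro x hx ⟨z, hz, hzx⟩ hix
            refine hn z hz (hC x hx hzx hix fun h => hi (hstart i hn ⟨z, hz, h⟩))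
          have hsub : (Q.filter fun x => ∃ z ∈ T, z.1 ∈ C x) ∪ (Q.filter fun x => i ∈ C x) ⊆
              Q.filter fun x => ∃ z ∈ T ++ [⟨i, a⟩], z.1 ∈ C x := by
            refine Finset.union_subset hmono fun x hx => ?_
            simp only [Finset.mem_filter] at hx ⊢
            exact ⟨hx.1, ⟨i, a⟩, by simp, hx.2⟩
          have := Finset.card_le_card hsub
          rw [Finset.card_union_of_disjoint hdisj] at this
          omega
    · push Not at hn
      obtain ⟨z₀, hz₀, hadj⟩ := hn
      -- Fibre `i` is already dominated through its touched neighbour, so the footprint lies in an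
      -- adjacent fibre `k` without touched neighbours.
      have hik : i ≠ k := by
        rintro rfl
        exact hnew z₀ hz₀ (mem_closedNbhd_xJoin_of_adj hadj)
      have hadj' : G.Adj i k :=
        (mem_closedNbhd_xJoin_of_ne (x := ⟨i, a⟩) (y := ⟨k, b⟩) hik).1 hy
      have hk : ∀ z ∈ T, ¬ G.Adj z.1 k := fun z hz h => hnew z hz (mem_closedNbhd_xJoin_of_adj h)
      have hIT' : ∀ j ∈ I, ∃ z ∈ T ++ [⟨i, a⟩], z.1 = j := fun j hj =>
        (hIT j hj).imp fun z hz => ⟨List.mem_append_left _ hz.1, hz.2⟩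
      have hold : ∀ j, (∀ z ∈ T ++ [⟨i, a⟩], ¬ G.Adj z.1 j) →
          ∀ z ∈ T ++ [⟨i, a⟩], z.1 = j → z ∈ T := by
        rintro j hj z hz rfl
        rcases List.mem_append.1 hz with hz | hz
        · exact hz
        · rw [List.mem_singleton.1 hz] at hj
          exact absurd hadj ((hnb _ hj).1 z₀ hz₀)
      have hstart' : ∀ j, (∀ z ∈ T ++ [⟨i, a⟩], ¬ G.Adj z.1 j) →
          (∃ z ∈ T ++ [⟨i, a⟩], z.1 = j) → j ∈ I := by
        rintro j hj ⟨z, hz, hzj⟩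
        exact hstart j (hnb _ hj).1 ⟨z, hold j hj z hz hzj, hzj⟩
      have hmem' : ∀ j, (∀ z ∈ T ++ [⟨i, a⟩], ¬ G.Adj z.1 j) →
          ∀ a', (⟨j, a'⟩ : Σ i, V i) ∈ T ++ [⟨i, a⟩] ↔ a' ∈ A j := fun j hj a' => by
        rw [← hmem j (hnb _ hj).1]
        exact ⟨fun h => hold j hj _ h rfl, List.mem_append_left _⟩
      -- If `k ∈ I`, the footprint `b` takes the place of the entry and extends `A k`, being its own
      -- new vertex there. The correspondence between `A k` and `T` is no longer required, since `k`
      -- now has the touched neighbour `i`.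
      by_cases hkI : k ∈ I
      · refine ⟨I, Function.update A k (A k ++ [b]), q, hI, hIT', ?_, hstart', ?_, ?_,
          hq.trans (Finset.card_le_card hmono)⟩
        · intro j
          rcases eq_or_ne j k with rfl | hj
          · simp only [Function.update_self]
            refine isLegal_concat.2 ⟨hA j, b, self_mem_closedNbhd b, fun a' ha' hb => ?_⟩
            exact hnew _ ((hmem _ hk a').2 ha') (mem_closedNbhd_xJoin_same.2 hb)
          · simpa [hj] using hA j
        · intro j hj
          have hjk : j ≠ k := by
            rintro rfl
            exact (hnb _ hj).2 hadj'
          simpa only [Function.update_of_ne hjk] using hmem' j hj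
        · rw [← Finset.add_sum_erase _ _ hkI]
          rw [← Finset.add_sum_erase _ _ hkI] at hlen
          rw [Finset.sum_congr rfl (g := fun j => (A j).length) fun j hj => by
            rw [Function.update_of_ne (Finset.ne_of_mem_erase hj)]]
          simp
          omega
      · refine ⟨I, A, q + 1, hI, hIT', hA, hstart', hmem', ?_, ?_⟩
        · simp
          omega
        · obtain ⟨w, hw, hiw, hkw⟩ := hE i k hadj'
          have hnot : w ∉ Q.filter fun x => ∃ z ∈ T, z.1 ∈ C x := by
            rintro h
            obtain ⟨z, hz, hzw⟩ := (Finset.mem_filter.1 h).2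
            exact hk z hz (hC w hw hzw hkw fun h => hkI (hstart k hk ⟨z, hz, h⟩))
          have hsub : insert w (Q.filter fun x => ∃ z ∈ T, z.1 ∈ C x) ⊆
              Q.filter fun x => ∃ z ∈ T ++ [⟨i, a⟩], z.1 ∈ C x := by
            refine Finset.insert_subset ?_ hmono
            simp only [Finset.mem_filter]
            exact ⟨hw, ⟨i, a⟩, by simp, hiw⟩
          have := Finset.card_le_card hsub
          rw [Finset.card_insert_of_notMem hnot] at this
          omega

open Classical in
/-- The upper bound for legal sequences of the product in terms of an edge clique cover. -/
theorem IsLegal.exists_indep [∀ i, Fintype (V i)] {κ : Type*} {Q : Finset κ} {C : κ → Set ι}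
    (hC : ∀ x ∈ Q, G.IsClique (C x)) (hE : ∀ i j, G.Adj i j → ∃ x ∈ Q, i ∈ C x ∧ j ∈ C x)
    {T : List (Σ i, V i)} (hT : (G.xJoin R).IsLegal T) :
    ∃ I : Finset ι, G.IsIndepSet (I : Set ι) ∧
      T.length + ∑ i ∈ I, (Q.filter fun x => i ∈ C x).card ≤
        Q.card + ∑ i ∈ I, (R i).grundyDomNumber := by
  obtain ⟨I, A, q, hI, -, hA, -, -, hlen, hq⟩ := hT.exists_indep_aux hC hE
  refine ⟨I, hI, ?_⟩
  have h1 : ∑ i ∈ I, (A i).length ≤ ∑ i ∈ I, (R i).grundyDomNumber :=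
    Finset.sum_le_sum fun i _ => (hA i).length_le_grundyDomNumber
  have h2 := Finset.card_filter_le Q fun x => ∃ z ∈ T, z.1 ∈ C x
  omega

end XJoin

end SimpleGraph

/-! ### Windows in powers of paths and the recursion for the optimum -/

section PathPower

open SimpleGraph

theorem SimpleGraph.Walk.le_add_length_of_pathGraph {n : ℕ} {a b : Fin n}
    (p : (pathGraph n).Walk a b) : (a : ℕ) ≤ b + p.length ∧ (b : ℕ) ≤ a + p.length := by
  induction p with
  | nil => simp
  | cons h p ih =>
    rw [pathGraph_adj] at h
    rw [Walk.length_cons]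
    omega

theorem exists_walk_pathGraph {n : ℕ} (d : ℕ) (a b : Fin n) (h : (b : ℕ) = a + d) :
    ∃ p : (pathGraph n).Walk a b, p.length = d := by
  induction d generalizing a with
  | zero =>
    obtain rfl : b = a := Fin.ext (by omega)
    exact ⟨.nil, rfl⟩
  | succ d ih =>
    have hb := b.2
    obtain ⟨p, hp⟩ := ih ⟨a + 1, by omega⟩ (by simp; omega)
    exact ⟨.cons (pathGraph_adj.2 (Or.inl rfl)) p, by simp [hp]⟩

theorem edist_pathGraph_le_iff {n m : ℕ} {a b : Fin n} :
    (pathGraph n).edist a b ≤ m ↔ (a : ℕ) ≤ b + m ∧ (b : ℕ) ≤ a + m := by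
  constructor
  · intro h
    obtain ⟨p, hp⟩ := exists_walk_of_edist_ne_top (ne_top_of_le_ne_top (ENat.natCast_ne_top m) h)
    rw [← hp, Nat.cast_le] at h
    have := p.le_add_length_of_pathGraph
    omega
  · intro h
    rcases le_total (a : ℕ) b with hab | hab
    · obtain ⟨p, hp⟩ := exists_walk_pathGraph (b - a) a b (by omega)
      exact (edist_le p).trans (by rw [hp]; exact_mod_cast by omega)
    · obtain ⟨p, hp⟩ := exists_walk_pathGraph (a - b) b a (by omega)
      rw [edist_comm]
      exact (edist_le p).trans (by rw [hp]; exact_mod_cast by omega)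

theorem pathPower_adj {n m : ℕ} {a b : Fin n} :
    (pathPower n m).Adj a b ↔ a ≠ b ∧ (a : ℕ) ≤ b + m ∧ (b : ℕ) ≤ a + m := by
  rw [← edist_pathGraph_le_iff]
  rfl

/-- The number of windows `{x, …, x + m}` with `x < n - m` that contain `k`. -/
def windowCount (n m k : ℕ) : ℕ := min (k + 1) (n - m) - (k - m)

theorem card_filter_window {n m k : ℕ} :
    ((Finset.range (n - m)).filter fun x => x ≤ k ∧ k ≤ x + m).card = windowCount n m k := by
  have : ((Finset.range (n - m)).filter fun x => x ≤ k ∧ k ≤ x + m) =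
      Finset.Ico (k - m) (min (k + 1) (n - m)) := by
    ext x
    simp only [Finset.mem_filter, Finset.mem_range, Finset.mem_Ico]
    omega
  rw [this, Nat.card_Ico, windowCount]

/-- The maximum of `∑ i ∈ I, (g i - windowCount n m i)` over the independent sets `I` of the
`m`-th power of a path that consist of numbers less than the argument. -/
def optValue (n m : ℕ) (g : ℕ → ℕ) : ℕ → ℕ
  | 0 => 0
  | k + 1 => optValue n m g k +
      (g k + optValue n m g (k - m) - (optValue n m g k + windowCount n m k))

/-- If `k` is the largest element allowed and belongs to `I`, the others are nonadjacent to it and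
hence less than `k - m`; otherwise the bound for `k` applies. -/
theorem sum_le_optValue {n m : ℕ} (g : ℕ → ℕ) (k : ℕ) (I : Finset (Fin n))
    (hI : (pathPower n m).IsIndepSet (I : Set (Fin n))) (hk : ∀ i ∈ I, (i : ℕ) < k) :
    ∑ i ∈ I, g i ≤ optValue n m g k + ∑ i ∈ I, windowCount n m i := by
  induction k using Nat.strong_induction_on generalizing I with
  | _ k ih =>
    rcases k with - | k
    · have : I = ∅ := Finset.eq_empty_of_forall_notMem fun i hi => by simpa using hk i hi
      simp [this]
    · rw [optValue]
      by_cases h : ∃ i ∈ I, (i : ℕ) = k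
      · obtain ⟨i, hi, rfl⟩ := h
        have := ih (i - m) (by omega) (I.erase i)
          (hI.mono (by exact_mod_cast Finset.erase_subset i I)) fun j hj => by
            have hj' := Finset.mem_of_mem_erase hj
            have hne := Finset.ne_of_mem_erase hj
            have h1 : ¬ (pathPower n m).Adj j i := hI hj' hi hne
            rw [pathPower_adj] at h1
            have h2 := hk j hj'
            have h3 : (j : ℕ) ≠ i := fun h => hne (Fin.ext h)
            have h4 : ¬ ((j : ℕ) ≤ i + m ∧ (i : ℕ) ≤ j + m) := fun h => h1 ⟨hne, h⟩
            omega
        rw [← Finset.add_sum_erase _ _ hi, ← Finset.add_sum_erase _ _ hi]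
        omega
      · push Not at h
        have := ih k (by omega) I hI fun i hi => by
          have h1 := hk i hi
          have h2 := h i hi
          omega
        omega

variable {n m : ℕ} {V : Fin n → Type u} {R : ∀ i, SimpleGraph (V i)}

theorem isClique_window (x : ℕ) :
    (pathPower n m).IsClique {i : Fin n | x ≤ (i : ℕ) ∧ (i : ℕ) ≤ x + m} := by
  rintro i ⟨hi, hi'⟩ j ⟨hj, hj'⟩ hij
  exact pathPower_adj.2 ⟨hij, by omega, by omega⟩

theorem exists_window_of_adj (hmn : m < n) {i j : Fin n} (h : (pathPower n m).Adj i j) :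
    ∃ x ∈ Finset.range (n - m), (x ≤ (i : ℕ) ∧ (i : ℕ) ≤ x + m) ∧
      (x ≤ (j : ℕ) ∧ (j : ℕ) ≤ x + m) := by
  obtain ⟨-, h1, h2⟩ := pathPower_adj.1 h
  have hi := i.2
  have hj := j.2
  -- The window starting at the smaller endpoint may stick out on the right; it is then shifted back
  -- to the last window.
  refine ⟨min (min i j) (n - m - 1), ?_, ?_⟩
  · rw [Finset.mem_range]
    omega
  · omega

/-- The upper bound for legal sequences of the product in terms of an independent set. -/
theorem SimpleGraph.IsLegal.exists_indep_pathPower [∀ i, Fintype (V i)] (hmn : m < n)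
    {T : List (Σ i, V i)} (hT : ((pathPower n m).xJoin R).IsLegal T) :
    ∃ I : Finset (Fin n), (pathPower n m).IsIndepSet (I : Set (Fin n)) ∧
      T.length + ∑ i ∈ I, windowCount n m i ≤ n - m + ∑ i ∈ I, (R i).grundyDomNumber := by
  obtain ⟨I, hI, h⟩ := hT.exists_indep (Q := Finset.range (n - m))
    (C := fun x => {i : Fin n | x ≤ (i : ℕ) ∧ (i : ℕ) ≤ x + m})
    (fun x _ => isClique_window x) (fun i j hij => exists_window_of_adj hmn hij)
  refine ⟨I, hI, ?_⟩
  rw [Finset.card_range] at h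
  convert h using 3 with i
  rw [← card_filter_window]
  congr!

/-! ### The sequence attaining the bound -/

/-- Extends `T` by treating the fibres `k - 1, …, 0`. At fibre `k` the whole list `L k` is
appended if the dynamic program selects `k`; otherwise, if no selected fibre lies in
`{k, …, k + m}` (for which `b` is the bound), a single entry of the list `L (k + m)`. -/
def traceSeq {α : Type*} (n m : ℕ) (g : ℕ → ℕ) (L : ℕ → List α) : ℕ → ℕ → List α → List α
  | 0, _, T => T
  | k + 1, b, T =>
    if k < b then
      if optValue n m g k < optValue n m g (k + 1) then traceSeq n m g L k (k - m) (T ++ L k)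
      else if k + m < n then traceSeq n m g L k b (T ++ (L (k + m)).take 1)
      else traceSeq n m g L k b T
    else traceSeq n m g L k b T

/-- The construction never inspects the vertices, so a machine that sees only their names computes
the names of the right sequence. -/
theorem traceSeq_map {α β : Type*} (f : α → β) (n m : ℕ) (g : ℕ → ℕ) (L : ℕ → List α)
    (k b : ℕ) (T : List α) :
    traceSeq n m g (fun i => (L i).map f) k b (T.map f) = (traceSeq n m g L k b T).map f := by
  induction k generalizing b T with
  | zero => rfl
  | succ k ih =>
    simp only [traceSeq]
    split_ifs <;> simp only [← ih, List.map_append, List.map_take]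

/-- The last summand counts the windows starting below `min b k`: each contributes one entry, except
that selecting a fibre forfeits the windows through it, a loss already subtracted in `optValue`. -/
theorem length_traceSeq {α : Type*} {g : ℕ → ℕ} {L : ℕ → List α}
    (hg : ∀ k < n, g k = (L k).length) (hL : ∀ k < n, L k ≠ []) (hmn : m < n)
    {k : ℕ} (hk : k ≤ n) (b : ℕ) (T : List α) :
    (traceSeq n m g L k b T).length =
      T.length + optValue n m g (min b k) + min (min b k) (n - m) := by
  induction k generalizing b T with
  | zero => simp [traceSeq, optValue]
  | succ k ih =>
    have ih := fun b T => ih (by omega) b T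
    simp only [traceSeq]
    split_ifs with hb hopt hkm
    · have h1 : optValue n m g (k + 1) = g k + optValue n m g (k - m) - windowCount n m k ∧
          windowCount n m k ≤ g k + optValue n m g (k - m) := by
        rw [optValue] at hopt ⊢
        omega
      rw [ih, List.length_append, ← hg k (by omega), min_eq_right (a := b) (by omega),
        min_eq_left (b := k) (by omega), h1.1]
      have := h1.2
      unfold windowCount at *
      omega
    · have h1 : optValue n m g (k + 1) = optValue n m g k := by
        rw [optValue] at hopt ⊢
        omega
      have h2 := List.length_pos_iff.2 (hL (k + m) hkm)
      rw [ih, List.length_append, List.length_take, min_eq_right (a := b) (b := k) (by omega),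
        min_eq_right (a := b) (b := k + 1) (by omega), h1]
      omega
    · have h1 : optValue n m g (k + 1) = optValue n m g k := by
        rw [optValue] at hopt ⊢
        omega
      rw [ih, min_eq_right (a := b) (b := k) (by omega),
        min_eq_right (a := b) (b := k + 1) (by omega), h1]
      omega
    · rw [ih, min_eq_left (a := b) (b := k) (by omega),
        min_eq_left (a := b) (b := k + 1) (by omega)]

/-- `T` dominates nothing in fibre `i`, so footprints within `R i` remain footprints in the product.
-/
theorem SimpleGraph.IsLegal.append_fibre {ι : Type*} {G : SimpleGraph ι} {V : ι → Type u}
    {R : ∀ i, SimpleGraph (V i)} {T : List (Σ i, V i)}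
    (hT : (G.xJoin R).IsLegal T) {i : ι} {B : List (V i)} (hB : (R i).IsLegal B)
    (h : ∀ z ∈ T, z.1 ≠ i ∧ ¬ G.Adj z.1 i) :
    (G.xJoin R).IsLegal (T ++ B.map (Sigma.mk i)) := by
  induction B using List.reverseRecOn with
  | nil => simpa using hT
  | append_singleton B x ih =>
    obtain ⟨hB, y, hy, hnew⟩ := isLegal_concat.1 hB
    rw [List.map_append, ← List.append_assoc]
    refine isLegal_concat.2 ⟨ih hB, ⟨i, y⟩, mem_closedNbhd_xJoin_same.2 hy, fun z hz => ?_⟩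
    rcases List.mem_append.1 hz with hz | hz
    · rw [mem_closedNbhd_xJoin_of_ne (h z hz).1]
      exact (h z hz).2
    · obtain ⟨a, ha, rfl⟩ := List.mem_map.1 hz
      rw [mem_closedNbhd_xJoin_same]
      exact hnew a ha

/-- The hypothesis `h` keeps every fibre below `min b k` entirely undominated by `T`. A single entry
from fibre `k + m` thus has its footprint in fibre `k`; `1 ≤ m` makes these fibres distinct. -/
theorem isLegal_traceSeq (hm : 1 ≤ m) {g : ℕ → ℕ} {L : ℕ → List (Σ i, V i)}
    {S : ∀ i, List (V i)} (hS : ∀ i, (R i).IsLegal (S i)) [∀ i, Nonempty (V i)]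
    (hL : ∀ i : Fin n, L i = (S i).map (Sigma.mk i)) {k : ℕ} (hk : k ≤ n) (b : ℕ)
    {T : List (Σ i, V i)} (hT : ((pathPower n m).xJoin R).IsLegal T)
    (h : ∀ z ∈ T, ∀ v < k, v < b → v + m < (z.1 : ℕ)) :
    ((pathPower n m).xJoin R).IsLegal (traceSeq n m g L k b T) := by
  induction k generalizing b T with
  | zero => exact hT
  | succ k ih =>
    have hkn : k < n := by omega
    simp only [traceSeq]
    split_ifs with hb hopt hkm
    · refine ih (by omega) _ ?_ ?_
      · rw [show L k = (S ⟨k, hkn⟩).map (Sigma.mk _) from hL ⟨k, hkn⟩]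
        refine hT.append_fibre (hS _) fun z hz => ?_
        have := h z hz k (by omega) hb
        rw [pathPower_adj, Ne, Fin.ext_iff]
        simp only
        omega
      · intro z hz v hv hvb
        rcases List.mem_append.1 hz with hz | hz
        · exact h z hz v (by omega) (by omega)
        · rw [show L k = (S ⟨k, hkn⟩).map (Sigma.mk _) from hL ⟨k, hkn⟩] at hz
          obtain ⟨a, -, rfl⟩ := List.mem_map.1 hz
          simp only
          omega
    · have hL' : L (k + m) = (S ⟨k + m, hkm⟩).map (Sigma.mk _) := hL ⟨k + m, hkm⟩
      have htake : (L (k + m)).take 1 = ((S ⟨k + m, hkm⟩).take 1).map (Sigma.mk _) := by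
        rw [hL', List.map_take]
      rw [htake]
      refine ih (by omega) _ ?_ ?_
      · rcases (S ⟨k + m, hkm⟩) with - | ⟨a, l⟩
        · simpa using hT
        · refine isLegal_concat.2 ⟨hT, ⟨⟨k, hkn⟩, Classical.arbitrary _⟩, ?_, fun z hz => ?_⟩
          · refine mem_closedNbhd_xJoin_of_adj (pathPower_adj.2 ?_)
            rw [Ne, Fin.ext_iff]
            simp only
            omega
          · have := h z hz k (by omega) hb
            rw [mem_closedNbhd_xJoin_of_ne (by rw [Ne, Fin.ext_iff]; simp only; omega),
              pathPower_adj]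
            simp only
            omega
      · intro z hz v hv hvb
        rcases List.mem_append.1 hz with hz | hz
        · exact h z hz v (by omega) (by omega)
        · obtain ⟨a, -, rfl⟩ := List.mem_map.1 hz
          simp only
          omega
    · exact ih (by omega) _ hT fun z hz v hv hvb => h z hz v (by omega) hvb
    · exact ih (by omega) _ hT fun z hz v hv hvb => h z hz v (by omega) hvb

theorem isGds_traceSeq [∀ i, Fintype (V i)] [∀ i, Nonempty (V i)] (hm : 1 ≤ m) (hmn : m < n)
    {g : ℕ → ℕ} {L : ℕ → List (Σ i, V i)} {S : ∀ i, List (V i)} (hS : ∀ i, (R i).IsGds (S i))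
    (hL : ∀ i : Fin n, L i = (S i).map (Sigma.mk i)) (hg : ∀ i : Fin n, g i = (S i).length) :
    ((pathPower n m).xJoin R).IsGds (traceSeq n m g L n n []) ∧
      ((pathPower n m).xJoin R).grundyDomNumber = n - m + optValue n m g n := by
  have hlen : (traceSeq n m g L n n []).length = n - m + optValue n m g n := by
    rw [length_traceSeq (fun k hk => ?_) (fun k hk => ?_) hmn le_rfl]
    · simp only [List.length_nil, min_self]
      omega
    · rw [show g k = _ from hg ⟨k, hk⟩, show L k = _ from hL ⟨k, hk⟩, List.length_map]
    · rw [show L k = _ from hL ⟨k, hk⟩, Ne, List.map_eq_nil_iff]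
      exact (hS _).ne_nil
  have hlegal : ((pathPower n m).xJoin R).IsLegal (traceSeq n m g L n n []) :=
    isLegal_traceSeq hm (fun i => (hS i).isLegal) hL le_rfl n isLegal_nil (by simp)
  rw [← hlen]
  refine hlegal.isGds_of_forall_length_le fun T hT => ?_
  obtain ⟨I, hI, h⟩ := hT.exists_indep_pathPower hmn
  have h' := sum_le_optValue g n I hI fun i _ => i.2
  rw [Finset.sum_congr rfl fun i _ => (hg i).trans (hS i).length_eq] at h'
  omega

/-! ### From the optimum to the weights of the theorem -/

/-- The two weight formulas are both of the form in `hw`: the extra term sits on the last `m + 1`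
vertices, a clique that some optimal independent set meets exactly once. -/
theorem grundyDomNumber_xJoin_pathPower [∀ i, Fintype (V i)] [∀ i, Nonempty (V i)]
    (hm : 1 ≤ m) (hmn : m < n) {w : Fin n → ℤ}
    (hw : ∀ i : Fin n, w i = (R i).grundyDomNumber - windowCount n m i +
      if n ≤ i + m + 1 then ((n - m : ℕ) : ℤ) else 0) :
    (((pathPower n m).xJoin R).grundyDomNumber : ℤ) = (pathPower n m).maxWeightIndep w := by
  choose S hS using fun i => (R i).exists_isGds
  set g : ℕ → ℕ := fun k => if h : k < n then (S ⟨k, h⟩).length else 0 with hg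
  set L : ℕ → List (Σ i, V i) :=
    fun k => if h : k < n then (S ⟨k, h⟩).map (Sigma.mk _) else [] with hL
  have hgS : ∀ i : Fin n, g i = (S i).length := fun i => by simp [hg]
  obtain ⟨hT, hγ⟩ := isGds_traceSeq (g := g) (L := L) hm hmn hS (fun i => by simp [hL]) hgS
  have hsum : ∀ I : Finset (Fin n), ∑ i ∈ I, w i = ((∑ i ∈ I, (R i).grundyDomNumber : ℕ) : ℤ) -
      ((∑ i ∈ I, windowCount n m i : ℕ) : ℤ) +
      ∑ i ∈ I, if n ≤ i + m + 1 then ((n - m : ℕ) : ℤ) else 0 := fun I => by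
    rw [Finset.sum_congr rfl fun i _ => hw i, Finset.sum_add_distrib, Finset.sum_sub_distrib]
    push_cast
    rfl
  have hhit : ∀ I : Finset (Fin n), (∃ i ∈ I, n ≤ (i : ℕ) + m + 1) →
      ((n - m : ℕ) : ℤ) ≤ ∑ i ∈ I, if n ≤ (i : ℕ) + m + 1 then ((n - m : ℕ) : ℤ) else 0 := by
    rintro I ⟨i, hi, hin⟩
    refine le_trans (by rw [if_pos hin]) (Finset.single_le_sum
      (f := fun i : Fin n => if n ≤ (i : ℕ) + m + 1 then ((n - m : ℕ) : ℤ) else 0)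
      (fun j _ => ?_) hi)
    split_ifs <;> positivity
  unfold SimpleGraph.maxWeightIndep
  refine le_antisymm ?_ (Finset.sup'_le _ _ fun I hI => ?_)
  · obtain ⟨I, hI, h⟩ := hT.isLegal.exists_indep_pathPower hmn
    rw [hT.length_eq] at h
    by_cases hlast : ∃ i ∈ I, n ≤ (i : ℕ) + m + 1
    · refine le_trans ?_ (Finset.le_sup' _ (b := I) (by simpa using hI))
      have := hhit I hlast
      rw [hsum]
      omega
    · push Not at hlast
      -- The last vertex lies in one window only and its fibre has positive Grundy number, so adding
      -- it loses nothing.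
      let l : Fin n := ⟨n - 1, by omega⟩
      have hl : l ∉ I := fun hl => by
        have := hlast l hl
        simp only [l] at this
        omega
      refine le_trans ?_ (Finset.le_sup' _ (b := insert l I) ?_)
      · have := hhit (insert l I) ⟨l, by simp, by simp only [l]; omega⟩
        have h1 := (R l).grundyDomNumber_pos
        have h2 : windowCount n m l = 1 := by
          simp only [windowCount, l]
          omega
        rw [hsum, Finset.sum_insert hl, Finset.sum_insert hl]
        omega
      · simp only [Finset.mem_filter, Finset.mem_univ, true_and, Finset.coe_insert]
        refine Set.pairwise_insert.2 ⟨hI, fun j hj hne => ?_⟩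
        have := hlast j hj
        rw [pathPower_adj, pathPower_adj]
        simp only [l]
        omega
  · have hI : (pathPower n m).IsIndepSet (I : Set (Fin n)) := by simpa using hI
    have h' := sum_le_optValue g n I hI fun i _ => i.2
    rw [Finset.sum_congr rfl fun i _ => (hgS i).trans (hS i).length_eq] at h'
    have hle : (∑ i ∈ I, if n ≤ (i : ℕ) + m + 1 then ((n - m : ℕ) : ℤ) else 0) ≤
        ((n - m : ℕ) : ℤ) := by
      by_cases hlast : ∃ i ∈ I, n ≤ (i : ℕ) + m + 1
      · obtain ⟨i, hi, hin⟩ := hlast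
        rw [Finset.sum_eq_single_of_mem i hi fun j hj hji => ?_]
        · rw [if_pos hin]
        · refine if_neg fun hjn => hI hj hi hji (pathPower_adj.2 ⟨hji, ?_⟩)
          have := i.2
          have := j.2
          omega
      · push Not at hlast
        rw [Finset.sum_eq_zero fun i hi => if_neg (not_le.2 (hlast i hi))]
        positivity
    rw [hsum]
    omega

theorem longPathWeight_eq (g : Fin n → ℕ) (hmn : 2 * m + 2 < n) (i : Fin n) :
    longPathWeight n m g i = g i - windowCount n m i +
      if n ≤ i + m + 1 then ((n - m : ℕ) : ℤ) else 0 := by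
  have := i.2
  simp only [longPathWeight, windowCount]
  split_ifs <;> omega

theorem shortPathWeight_eq (g : Fin n → ℕ) (hmn : m + 2 ≤ n) (hnm : n ≤ 2 * m + 2)
    (i : Fin n) :
    shortPathWeight n m g i = g i - windowCount n m i +
      if n ≤ i + m + 1 then ((n - m : ℕ) : ℤ) else 0 := by
  have := i.2
  simp only [shortPathWeight, windowCount]
  split_ifs <;> omega

end PathPower

/-! ### Size bounds for the numbers in the computation -/

theorem optValue_le_succ (n m : ℕ) (g : ℕ → ℕ) (k : ℕ) :
    optValue n m g k ≤ optValue n m g (k + 1) := by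
  rw [optValue]
  omega

theorem optValue_mono (n m : ℕ) (g : ℕ → ℕ) : Monotone (optValue n m g) :=
  monotone_nat_of_le_succ (optValue_le_succ n m g)

theorem optValue_succ_le (n m : ℕ) (g : ℕ → ℕ) (k : ℕ) :
    optValue n m g (k + 1) ≤ optValue n m g k + g k := by
  have := optValue_mono n m g (Nat.sub_le k m)
  rw [optValue]
  omega

/-- The address at which the `k`-th list of the input starts (with its length), for lists of
lengths `g 0, g 1, …`. -/
def blockStart (g : ℕ → ℕ) : ℕ → ℕ
  | 0 => 2
  | k + 1 => blockStart g k + g k + 1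

theorem blockStart_mono (g : ℕ → ℕ) : Monotone (blockStart g) :=
  monotone_nat_of_le_succ fun k => by
    rw [blockStart]
    omega

theorem blockStart_add_lt {g : ℕ → ℕ} {k n : ℕ} (h : k < n) :
    blockStart g k + g k < blockStart g n := by
  have := blockStart_mono g h
  rw [Nat.succ_eq_add_one, blockStart] at this
  omega

theorem add_two_le_blockStart (g : ℕ → ℕ) (k : ℕ) : k + 2 ≤ blockStart g k := by
  induction k with
  | zero => rfl
  | succ k ih =>
    rw [blockStart]
    omega

/-- Keeps the table of optimal values within linear word size. -/
theorem optValue_le_blockStart (n m : ℕ) (g : ℕ → ℕ) (k : ℕ) :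
    optValue n m g k ≤ blockStart g k := by
  induction k with
  | zero => simp [optValue]
  | succ k ih =>
    have := optValue_succ_le n m g k
    rw [blockStart]
    omega

/-! ### The program and its building blocks -/

namespace RAM

/-- The memory `M` holds the list `l` from the address `a` on. -/
def Holds (M : ℕ → ℕ) (a : ℕ) (l : List ℕ) : Prop :=
  ∀ (j : ℕ) (h : j < l.length), M (a + j) = l[j]

theorem holds_nil (M : ℕ → ℕ) (a : ℕ) : Holds M a [] := fun j h => by simp at h

theorem Holds.concat {M : ℕ → ℕ} {a : ℕ} {l : List ℕ} (h : Holds M a l) (v : ℕ) :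
    Holds (Function.update M (a + l.length) v) a (l ++ [v]) := by
  intro j hj
  rw [List.length_append, List.length_singleton] at hj
  rcases Nat.lt_or_ge j l.length with hjl | hjl
  · rw [Function.update_of_ne (by omega), List.getElem_append_left hjl]
    exact h j hjl
  · obtain rfl : j = l.length := by omega
    simp

theorem output_eq_of_holds {s : State} {l : List ℕ} (h : Holds s.mem (s.reg 0) l)
    (hlen : s.reg 1 = l.length) : s.output = l := by
  refine List.ext_getElem (by simp [State.output, hlen]) fun j h1 h2 => ?_
  simpa [State.output] using h j h2

/-- A sequence of elementary operations as a program. -/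
def block : List Op → Prog
  | [] => .skip
  | o :: l => .seq (.op o) (block l)

/-- The effect of a sequence of elementary operations. -/
def runAll : List Op → State → State
  | [], s => s
  | o :: l, s => runAll l (o.run s)

/-- No operation of the sequence overflows. -/
def FitsAll (W : ℕ) : List Op → State → Prop
  | [], _ => True
  | o :: l, s => o.Fits W s ∧ FitsAll W l (o.run s)

theorem Exec.block {W : ℕ} {l : List Op} {s : State} (h : FitsAll W l s) :
    Exec W (block l) s (l.length + 1) (runAll l s) := by
  induction l generalizing s with
  | nil => exact .skip s
  | cons o l ih =>
    rw [List.length_cons, show l.length + 1 + 1 = 1 + (l.length + 1) by omega]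
    exact .seq (.op o s h.1) (ih h.2)

/-- A loop with at most `c` steps per pass, for which `Inv i` holds before the `i`-th pass. -/
theorem Exec.exists_whileLt {W a b : ℕ} {p : Prog} (Inv : ℕ → State → Prop) (c K : ℕ)
    (hstep : ∀ i < K, ∀ s, Inv i s →
      s.reg a < s.reg b ∧ ∃ t s', Exec W p s t s' ∧ t ≤ c ∧ Inv (i + 1) s')
    (hend : ∀ s, Inv K s → ¬ s.reg a < s.reg b) {s : State} (hs : Inv 0 s) :
    ∃ t s', Exec W (.whileLt a b p) s t s' ∧ t ≤ (c + 1) * K + 1 ∧ Inv K s' := by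
  suffices ∀ d i, i + d = K → ∀ s, Inv i s →
      ∃ t s', Exec W (.whileLt a b p) s t s' ∧ t ≤ (c + 1) * d + 1 ∧ Inv K s' from
    this K 0 (by omega) s hs
  intro d
  induction d with
  | zero =>
    rintro i rfl s hs
    exact ⟨1, s, .whileFalse (hend s hs), by omega, hs⟩
  | succ d ih =>
    intro i hi s hs
    obtain ⟨hlt, t, s', he, ht, hs'⟩ := hstep i (by omega) s hs
    obtain ⟨t', s'', he', ht', hs''⟩ := ih (i + 1) (by omega) s' hs'
    refine ⟨_, s'', .whileTrue hlt he he', ?_, hs''⟩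
    rw [Nat.mul_succ]
    omega

/-- One pass of the loop that finds the end of the input. -/
def scanOps : List Op := [.load 7 6, .add 6 6 7, .add 6 6 4, .add 5 5 4]

/-- Sets up the addresses of the two tables and of the output. -/
def setupOps : List Op :=
  [.move 8 6, .add 9 8 2, .add 0 9 2, .add 0 0 4, .const 5 0, .const 6 2, .store 9 10,
    .sub 11 2 3]

/-- One pass of the dynamic program: one entry of the table of addresses, one of the table of
optimal values. -/
def tableOps : List Op :=
  [.add 12 8 5, .load 13 6, .add 14 9 5, .load 15 14, .sub 16 5 3, .add 17 9 16, .load 18 17,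
    .add 19 5 4, .sub 20 19 11, .sub 20 19 20, .sub 20 20 16, .add 21 15 20, .add 22 13 18,
    .sub 22 22 21, .add 15 15 22, .add 14 14 4, .store 12 6, .store 14 15, .add 6 6 13,
    .add 6 6 4, .add 5 5 4]

/-- Copies one word to the end of the output. -/
def copyOps : List Op := [.add 6 6 4, .load 17 6, .store 24 17, .add 24 24 4]

/-- One pass of the loop that traces the optimal values back and writes the output. -/
def traceBody : Prog :=
  .seq (.op (.sub 5 5 4)) <|
  .ifLt 5 23
    (.seq (block [.add 14 9 5, .load 15 14, .add 14 14 4, .load 16 14]) <|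
      .ifLt 15 16
        (.seq (block [.add 12 8 5, .load 6 12, .load 13 6, .add 13 6 13, .sub 23 5 3])
          (.whileLt 6 13 (block copyOps)))
        (.seq (.op (.add 17 5 3)) <|
          .ifLt 17 2 (.seq (block [.add 12 8 17, .load 6 12]) (block copyOps)) .skip))
    .skip

/-- The program that computes a Grundy dominating sequence of the product. -/
def grundyProg : Prog :=
  .seq (block [.const 4 1, .load 2 0, .load 3 4, .const 6 2]) <|
  .seq (.whileLt 5 2 (block scanOps)) <|
  .seq (block setupOps) <|
  .seq (.whileLt 5 2 (block tableOps)) <|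
  .seq (block [.move 23 2, .move 24 0]) <|
  .seq (.whileLt 10 5 traceBody) <|
  .op (.sub 1 24 0)

/-! ### Correctness and running time of the program -/

section Correctness

variable {W n m : ℕ} {g : ℕ → ℕ} {M : ℕ → ℕ}

theorem exists_exec_scan (hM : ∀ k < n, M (blockStart g k) = g k)
    (hW : 5 * blockStart g n ≤ W) {s : State} (hs : s.mem = M ∧ s.reg 2 = n ∧ s.reg 3 = m ∧
      s.reg 4 = 1 ∧ s.reg 5 = 0 ∧ s.reg 6 = 2 ∧ s.reg 10 = 0) :
    ∃ t s', Exec W (.whileLt 5 2 (block scanOps)) s t s' ∧ t ≤ 6 * n + 1 ∧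
      s'.mem = M ∧ s'.reg 2 = n ∧ s'.reg 3 = m ∧ s'.reg 4 = 1 ∧ s'.reg 6 = blockStart g n ∧
      s'.reg 10 = 0 := by
  obtain ⟨t, s', he, ht, h1, h2, h3, h4, h5, h6, h7⟩ :=
    Exec.exists_whileLt (W := W) (a := 5) (b := 2) (p := block scanOps)
    (fun i s => s.mem = M ∧ s.reg 2 = n ∧ s.reg 3 = m ∧ s.reg 4 = 1 ∧ s.reg 5 = i ∧
      s.reg 6 = blockStart g i ∧ s.reg 10 = 0) 5 n
    (fun i hi s ⟨h1, h2, h3, h4, h5, h6, h7⟩ => by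
      have hlt := blockStart_add_lt (g := g) hi
      have hn := add_two_le_blockStart g n
      have hMi := hM i hi
      refine ⟨by omega, _, _, Exec.block ?_, le_rfl, ?_⟩
      · simp [scanOps, FitsAll, Op.run, Op.Fits, h1, h4, h5, h6, hMi]
        omega
      · simp [scanOps, runAll, Op.run, h1, h2, h3, h4, h5, h6, h7, hMi, blockStart])
    (fun s h => by omega) hs
  exact ⟨t, s', he, ht, h1, h2, h3, h4, h6, h7⟩

/-- Behind the input, of length `blockStart g n`, lie `n` block addresses, then `n + 1` optimal
values, then the output. The addresses are stored because blocks of varying length can be located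
only from left to right, while the trace runs from right to left. -/
theorem exists_exec_table (hM : ∀ k < n, M (blockStart g k) = g k)
    (hW : 5 * blockStart g n ≤ W) {s : State}
    (hs : (∀ a < blockStart g n, s.mem a = M a) ∧ s.mem (blockStart g n + n) = 0 ∧
      s.reg 0 = blockStart g n + n + n + 1 ∧ s.reg 2 = n ∧ s.reg 3 = m ∧ s.reg 4 = 1 ∧
      s.reg 5 = 0 ∧ s.reg 6 = 2 ∧ s.reg 8 = blockStart g n ∧ s.reg 9 = blockStart g n + n ∧
      s.reg 10 = 0 ∧ s.reg 11 = n - m) :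
    ∃ t s', Exec W (.whileLt 5 2 (block tableOps)) s t s' ∧ t ≤ 23 * n + 1 ∧
      (∀ a < blockStart g n, s'.mem a = M a) ∧
      (∀ k < n, s'.mem (blockStart g n + k) = blockStart g k) ∧
      (∀ k ≤ n, s'.mem (blockStart g n + n + k) = optValue n m g k) ∧
      s'.reg 0 = blockStart g n + n + n + 1 ∧ s'.reg 2 = n ∧ s'.reg 3 = m ∧ s'.reg 4 = 1 ∧
      s'.reg 5 = n ∧ s'.reg 8 = blockStart g n ∧ s'.reg 9 = blockStart g n + n ∧
      s'.reg 10 = 0 := by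
  obtain ⟨t, s', he, ht, h1, h2, h3, h4, h5, h6, h7, h8, h9, h10, h11, h12, h13⟩ :=
    Exec.exists_whileLt (W := W) (a := 5) (b := 2) (p := block tableOps)
    (fun i s => (∀ a < blockStart g n, s.mem a = M a) ∧
      (∀ k < i, s.mem (blockStart g n + k) = blockStart g k) ∧
      (∀ k ≤ i, s.mem (blockStart g n + n + k) = optValue n m g k) ∧
      s.reg 0 = blockStart g n + n + n + 1 ∧ s.reg 2 = n ∧ s.reg 3 = m ∧ s.reg 4 = 1 ∧
      s.reg 5 = i ∧ s.reg 6 = blockStart g i ∧ s.reg 8 = blockStart g n ∧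
      s.reg 9 = blockStart g n + n ∧ s.reg 10 = 0 ∧ s.reg 11 = n - m) 22 n
    (fun i hi s ⟨h1, h2, h3, h4, h5, h6, h7, h8, h9, h10, h11, h12, h13⟩ => by
      have hlt := blockStart_add_lt (g := g) hi
      have hn := add_two_le_blockStart g n
      have hg : s.mem (blockStart g i) = g i := by rw [h1 _ (by omega), hM i hi]
      have hopt := h3 i le_rfl
      have hopt' := h3 (i - m) (by omega)
      have hb1 := optValue_le_blockStart n m g i
      have hb2 := optValue_mono n m g (Nat.sub_le i m)
      have hb3 := optValue_succ_le n m g i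
      -- The machine computes `min a b` as the truncated difference `a - (a - b)`.
      have hcount : i + 1 - (i + 1 - (n - m)) - (i - m) = windowCount n m i := by
        rw [windowCount]
        omega
      have hcount' : windowCount n m i ≤ n := by
        rw [windowCount]
        omega
      have hsucc : optValue n m g i + (g i + optValue n m g (i - m) -
          (optValue n m g i + windowCount n m i)) = optValue n m g (i + 1) := by
        rw [optValue]
      refine ⟨by omega, _, _, Exec.block ?_, le_rfl, ?_⟩
      · simp only [tableOps, FitsAll, Op.run, Op.Fits, Function.update_apply, h6, h7, h8, h9, h10,
          h11, h13, hg, hopt, hopt', hcount, hsucc, Nat.reduceEqDiff,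
          if_true, if_false, true_and, and_true]
        omega
      · simp only [tableOps, runAll, Op.run, Function.update_apply, h4, h5, h6, h7, h8, h9, h10,
          h11, h12, h13, hg, hopt, hopt', hcount, hsucc, Nat.reduceEqDiff,
          if_true, if_false, true_and, and_true]
        refine ⟨fun a ha => ?_, fun k hk => ?_, fun k hk => ?_, ?_⟩
        · rw [if_neg (by omega), if_neg (by omega), h1 a ha]
        · rw [if_neg (by omega)]
          split_ifs with h
          · rw [show k = i by omega]
          · exact h2 k (by omega)
        · split_ifs with h h'
          · rw [show k = i + 1 by omega]
          · omega
          · exact h3 k (by omega)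
        · rw [blockStart])
    (fun s h => by omega)
    ⟨hs.1, by simp, fun k hk => by
      obtain rfl : k = 0 := by omega
      simpa [optValue] using hs.2.1, hs.2.2.1, hs.2.2.2.1, hs.2.2.2.2.1, hs.2.2.2.2.2.1,
      hs.2.2.2.2.2.2.1, hs.2.2.2.2.2.2.2.1, hs.2.2.2.2.2.2.2.2⟩
  exact ⟨t, s', he, ht, h1, h2, h3, h4, h5, h6, h7, h8, h10, h11, h12⟩

/-- The state of the machine in the trace loop when the fibres `k - 1, …, 0` are left, the fibres
below `b` can still be selected, and `T` has been written. -/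
structure TraceInv (n m : ℕ) (g : ℕ → ℕ) (M : ℕ → ℕ) (k b : ℕ) (T : List ℕ) (s : State) :
    Prop where
  reg0 : s.reg 0 = blockStart g n + n + n + 1
  reg2 : s.reg 2 = n
  reg3 : s.reg 3 = m
  reg4 : s.reg 4 = 1
  reg5 : s.reg 5 = k
  reg8 : s.reg 8 = blockStart g n
  reg9 : s.reg 9 = blockStart g n + n
  reg10 : s.reg 10 = 0
  reg23 : s.reg 23 = b
  reg24 : s.reg 24 = blockStart g n + n + n + 1 + T.length
  mem : ∀ a < blockStart g n + n + n + 1, s.mem a = M a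
  holds : Holds s.mem (blockStart g n + n + n + 1) T

variable {L : ℕ → List ℕ}

theorem TraceInv.congr {k b : ℕ} {T : List ℕ} {s s' : State} (hs : TraceInv n m g M k b T s)
    (hreg : ∀ r ∈ [0, 2, 3, 4, 5, 8, 9, 10, 23, 24], s'.reg r = s.reg r) (hmem : s'.mem = s.mem) :
    TraceInv n m g M k b T s' where
  reg0 := (hreg 0 (by simp)).trans hs.reg0
  reg2 := (hreg 2 (by simp)).trans hs.reg2
  reg3 := (hreg 3 (by simp)).trans hs.reg3
  reg4 := (hreg 4 (by simp)).trans hs.reg4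
  reg5 := (hreg 5 (by simp)).trans hs.reg5
  reg8 := (hreg 8 (by simp)).trans hs.reg8
  reg9 := (hreg 9 (by simp)).trans hs.reg9
  reg10 := (hreg 10 (by simp)).trans hs.reg10
  reg23 := (hreg 23 (by simp)).trans hs.reg23
  reg24 := (hreg 24 (by simp)).trans hs.reg24
  mem := hmem ▸ hs.mem
  holds := hmem ▸ hs.holds

/-- The pointer is advanced before reading, so starting at the address of a block skips its length
word. -/
theorem exists_exec_copyOps (hW : 5 * blockStart g n ≤ W) {k b a : ℕ} {T : List ℕ}
    (hT : T.length < blockStart g n) (ha : a + 1 < blockStart g n) {s : State}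
    (hs : TraceInv n m g M k b T s) (h6 : s.reg 6 = a) :
    ∃ s', Exec W (block copyOps) s 5 s' ∧ TraceInv n m g M k b (T ++ [M (a + 1)]) s' ∧
      s'.reg 6 = a + 1 ∧ s'.reg 13 = s.reg 13 := by
  have hn := add_two_le_blockStart g n
  have hval : s.mem (a + 1) = M (a + 1) := hs.mem _ (by omega)
  refine ⟨_, Exec.block ?_, ⟨?_, ?_, ?_, ?_, ?_, ?_, ?_, ?_, ?_, ?_, ?_, ?_⟩, ?_, ?_⟩
  case refine_1 =>
    simp only [copyOps, FitsAll, Op.run, Op.Fits, Function.update_apply, h6, hs.reg4, hs.reg24,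
      Nat.reduceEqDiff, if_true, if_false, true_and, and_true]
    omega
  case refine_12 =>
    intro c hc
    have hne : c ≠ blockStart g n + n + n + 1 + T.length := by omega
    simp [copyOps, runAll, Op.run, h6, hs.reg4, hs.reg24, hne, hs.mem c hc]
  case refine_13 =>
    simpa [copyOps, runAll, Op.run, h6, hs.reg4, hs.reg24, hval] using hs.holds.concat (M (a + 1))
  all_goals simp [copyOps, runAll, Op.run, h6, hs.reg0, hs.reg2, hs.reg3, hs.reg4, hs.reg5, hs.reg8,
    hs.reg9, hs.reg10, hs.reg23, hs.reg24, add_assoc]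

theorem exists_exec_copy (hL : ∀ k < n, Holds M (blockStart g k + 1) (L k))
    (hg : ∀ k < n, g k = (L k).length) (hW : 5 * blockStart g n ≤ W) {k i b : ℕ} {T : List ℕ}
    (hi : i < n) (hT : T.length + g i < blockStart g n)
    {s : State} (hs : TraceInv n m g M k b T s) (h6 : s.reg 6 = blockStart g i)
    (h13 : s.reg 13 = blockStart g i + g i) :
    ∃ t s', Exec W (.whileLt 6 13 (block copyOps)) s t s' ∧ t ≤ 6 * g i + 1 ∧
      TraceInv n m g M k b (T ++ L i) s' := by
  have hlt := blockStart_add_lt (g := g) hi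
  have hlen := hg i hi
  obtain ⟨t, s', he, ht, h1, -, -⟩ :=
    Exec.exists_whileLt (W := W) (a := 6) (b := 13) (p := block copyOps)
    (fun j s => TraceInv n m g M k b (T ++ (L i).take j) s ∧ s.reg 6 = blockStart g i + j ∧
      s.reg 13 = blockStart g i + g i) 5 (g i)
    (fun j hj s ⟨hs, h6, h13⟩ => by
      have hval : M (blockStart g i + j + 1) = (L i)[j] := by
        rw [← hL i hi j (by omega), add_right_comm]
      obtain ⟨s', he, hs', h6', h13'⟩ := exists_exec_copyOps hW
        (by rw [List.length_append, List.length_take]; omega) (by omega) hs h6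
      rw [hval, List.append_assoc, List.take_append_getElem] at hs'
      exact ⟨by omega, _, s', he, le_rfl, hs', h6', h13'.trans h13⟩)
    (fun s h => by omega) (s := s) ⟨by simpa using hs, by simpa using h6, h13⟩
  refine ⟨t, s', he, ht, ?_⟩
  rwa [List.take_of_length_le hlen.ge] at h1

/-- Time and output of one pass are both charged to the block of fibre `k`, of size `g k + 1`, even
if the single word written comes from block `k + m`. The bound on `T'.length` is what keeps output
addresses below `W`. -/
theorem exists_exec_traceBody (hB : ∀ k < n, M (blockStart g n + k) = blockStart g k)
    (hO : ∀ k ≤ n, M (blockStart g n + n + k) = optValue n m g k)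
    (hG : ∀ k < n, M (blockStart g k) = g k) (hL : ∀ k < n, Holds M (blockStart g k + 1) (L k))
    (hg : ∀ k < n, g k = (L k).length) (hne : ∀ k < n, L k ≠ []) (hmn : m < n)
    (hW : 5 * blockStart g n ≤ W) {k b : ℕ} {T : List ℕ} (hk : k < n)
    (hT : T.length + blockStart g (k + 1) ≤ blockStart g n)
    {s : State} (hs : TraceInv n m g M (k + 1) b T s) :
    ∃ t s' b' T', Exec W traceBody s t s' ∧ t ≤ 30 * (g k + 1) ∧ TraceInv n m g M k b' T' s' ∧
      T'.length + blockStart g k ≤ blockStart g n ∧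
      traceSeq n m g L (k + 1) b T = traceSeq n m g L k b' T' := by
  have hn := add_two_le_blockStart g n
  rw [blockStart] at hT
  have hlt := blockStart_add_lt (g := g) hk
  have e1 : Exec W (.op (.sub 5 5 4)) s 1 _ := .op _ s trivial
  have i1 : TraceInv n m g M k b T ((Op.sub 5 5 4).run s) := by
    refine ⟨?_, ?_, ?_, ?_, ?_, ?_, ?_, ?_, ?_, ?_, hs.mem, hs.holds⟩ <;>
    simp [Op.run, hs.reg0, hs.reg2, hs.reg3, hs.reg4, hs.reg5, hs.reg8, hs.reg9,
      hs.reg10, hs.reg23, hs.reg24]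
  generalize (Op.sub 5 5 4).run s = s₁ at e1 i1
  have hm1 : s₁.mem (blockStart g n + n + k) = optValue n m g k := by
    rw [i1.mem _ (by omega), hO k hk.le]
  have hm2 : s₁.mem (blockStart g n + n + k + 1) = optValue n m g (k + 1) := by
    rw [i1.mem _ (by omega), ← hO (k + 1) hk]
    rfl
  obtain ⟨s₂, e2, i2, h15, h16⟩ : ∃ s₂,
      Exec W (block [.add 14 9 5, .load 15 14, .add 14 14 4, .load 16 14]) s₁ 5 s₂ ∧
      TraceInv n m g M k b T s₂ ∧ s₂.reg 15 = optValue n m g k ∧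
      s₂.reg 16 = optValue n m g (k + 1) := by
    refine ⟨_, Exec.block ?_, i1.congr ?_ ?_, ?_, ?_⟩
    · simp [FitsAll, Op.run, Op.Fits, i1.reg9, i1.reg5, i1.reg4]
      omega
    all_goals simp [runAll, Op.run, i1.reg9, i1.reg5, i1.reg4, hm1, hm2]
  simp only [traceSeq]
  split_ifs with hb hopt hkm
  · have hm3 : s₂.mem (blockStart g n + k) = blockStart g k := by
      rw [i2.mem _ (by omega), hB k hk]
    have hm4 : s₂.mem (blockStart g k) = g k := by
      rw [i2.mem _ (by omega), hG k hk]
    obtain ⟨s₃, e3, i3, h6, h13⟩ : ∃ s₃,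
        Exec W (block [.add 12 8 5, .load 6 12, .load 13 6, .add 13 6 13, .sub 23 5 3]) s₂ 6 s₃ ∧
        TraceInv n m g M k (k - m) T s₃ ∧ s₃.reg 6 = blockStart g k ∧
        s₃.reg 13 = blockStart g k + g k := by
      refine ⟨_, Exec.block ?_, ⟨?_, ?_, ?_, ?_, ?_, ?_, ?_, ?_, ?_, ?_, i2.mem, i2.holds⟩, ?_, ?_⟩
      · simp [FitsAll, Op.run, Op.Fits, i2.reg8, i2.reg5, hm3, hm4]
        omega
      all_goals simp [runAll, Op.run, i2.reg0, i2.reg2, i2.reg3, i2.reg4, i2.reg5, i2.reg8,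
        i2.reg9, i2.reg10, i2.reg24, hm3, hm4]
    obtain ⟨t, s₄, e4, ht, i4⟩ := exists_exec_copy hL hg hW hk (by omega) i3 h6 h13
    refine ⟨_, s₄, k - m, T ++ L k, e1.seq (.ifTrue (by rw [i1.reg5, i1.reg23]; exact hb)
      (e2.seq (.ifTrue (by rw [h15, h16]; exact hopt) (e3.seq e4)))), by omega, i4, ?_, rfl⟩
    rw [List.length_append, ← hg k hk]
    omega
  · have hlt' := blockStart_add_lt (g := g) hkm
    have hm3 : s₂.mem (blockStart g n + (k + m)) = blockStart g (k + m) := by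
      rw [i2.mem _ (by omega), hB _ hkm]
    have hpos := List.length_pos_iff.2 (hne _ hkm)
    have hval : M (blockStart g (k + m) + 1) = (L (k + m))[0] := hL _ hkm 0 hpos
    have e3 : Exec W (.op (.add 17 5 3)) s₂ 1 _ := .op _ s₂ (by
      simp only [Op.Fits, i2.reg5, i2.reg3]
      omega)
    obtain ⟨s₄, e4, i4, h6⟩ : ∃ s₄, Exec W (block [.add 12 8 17, .load 6 12])
        ((Op.add 17 5 3).run s₂) 3 s₄ ∧
        TraceInv n m g M k b T s₄ ∧ s₄.reg 6 = blockStart g (k + m) := by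
      refine ⟨_, Exec.block ?_, i2.congr ?_ ?_, ?_⟩
      · simp [FitsAll, Op.run, Op.Fits, i2.reg8, i2.reg5, i2.reg3]
        omega
      all_goals simp [runAll, Op.run, i2.reg8, i2.reg5, i2.reg3, hm3]
    have := hg _ hkm
    obtain ⟨s₅, e5, i5, -, -⟩ := exists_exec_copyOps hW (by omega) (by omega) i4 h6
    refine ⟨_, s₅, b, _, e1.seq (.ifTrue (by rw [i1.reg5, i1.reg23]; exact hb)
      (e2.seq (.ifFalse (by rw [h15, h16]; exact hopt)
        (e3.seq (.ifTrue (by simp [Op.run, i2.reg5, i2.reg3, i2.reg2]; exact hkm)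
          (e4.seq e5)))))), by omega, i5, ?_, ?_⟩
    · rw [List.length_append, List.length_singleton]
      omega
    · rw [hval]
      congr 2
      rw [List.take_one, List.head?_eq_getElem?, List.getElem?_eq_getElem hpos]
      rfl
  · refine ⟨_, _, b, T, e1.seq (.ifTrue (by rw [i1.reg5, i1.reg23]; exact hb)
      (e2.seq (.ifFalse (by rw [h15, h16]; exact hopt)
        (.seq (.op _ s₂ (by simp only [Op.Fits, i2.reg5, i2.reg3]; omega))
          (.ifFalse (by simp [Op.run, i2.reg5, i2.reg3, i2.reg2]; omega) (.skip _)))))),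
      by omega, i2.congr (by simp [Op.run]) rfl, by omega, rfl⟩
  · exact ⟨_, s₁, b, T, e1.seq (.ifFalse (by rw [i1.reg5, i1.reg23]; exact hb) (.skip _)), by omega,
      i1, by omega, rfl⟩

/-- Summing the costs `30 * (g k + 1)`, plus one test per pass, over all blocks telescopes to a
multiple of `blockStart`. -/
theorem exists_exec_trace (hB : ∀ k < n, M (blockStart g n + k) = blockStart g k)
    (hO : ∀ k ≤ n, M (blockStart g n + n + k) = optValue n m g k)
    (hG : ∀ k < n, M (blockStart g k) = g k) (hL : ∀ k < n, Holds M (blockStart g k + 1) (L k))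
    (hg : ∀ k < n, g k = (L k).length) (hne : ∀ k < n, L k ≠ []) (hmn : m < n)
    (hW : 5 * blockStart g n ≤ W) {k b : ℕ} {T : List ℕ} (hk : k ≤ n)
    (hT : T.length + blockStart g k ≤ blockStart g n)
    {s : State} (hs : TraceInv n m g M k b T s) :
    ∃ t s' b', Exec W (.whileLt 10 5 traceBody) s t s' ∧ t ≤ 31 * blockStart g k ∧
      TraceInv n m g M 0 b' (traceSeq n m g L k b T) s' := by
  induction k generalizing b T s with
  | zero => exact ⟨1, s, b, .whileFalse (by simp [hs.reg10, hs.reg5]), by simp [blockStart], hs⟩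
  | succ k ih =>
    obtain ⟨t, s', b', T', he, ht, hs', hT', heq⟩ :=
      exists_exec_traceBody hB hO hG hL hg hne hmn hW hk hT hs
    obtain ⟨t', s'', b'', he', ht', hs''⟩ := ih (by omega) hT' hs'
    refine ⟨_, s'', b'', .whileTrue (by simp [hs.reg10, hs.reg5]) he he', ?_, heq ▸ hs''⟩
    rw [blockStart]
    omega

theorem exists_exec_grundyProg (hM0 : M 0 = n) (hM1 : M 1 = m)
    (hG : ∀ k < n, M (blockStart g k) = g k) (hL : ∀ k < n, Holds M (blockStart g k + 1) (L k))
    (hg : ∀ k < n, g k = (L k).length) (hne : ∀ k < n, L k ≠ []) (hmn : m < n) (hW : 5 * blockStart g n ≤ W) :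
    ∃ t s, Exec W grundyProg ⟨fun _ => 0, M⟩ t s ∧ t ≤ 100 * blockStart g n ∧
      s.output = traceSeq n m g L n n [] := by
  have hn := add_two_le_blockStart g n
  obtain ⟨s₁, e1, h1⟩ : ∃ s₁, Exec W (block [.const 4 1, .load 2 0, .load 3 4, .const 6 2])
      ⟨fun _ => 0, M⟩ 5 s₁ ∧ s₁.mem = M ∧ s₁.reg 2 = n ∧ s₁.reg 3 = m ∧ s₁.reg 4 = 1 ∧
      s₁.reg 5 = 0 ∧ s₁.reg 6 = 2 ∧ s₁.reg 10 = 0 := by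
    refine ⟨_, Exec.block ?_, ?_⟩
    · simp [FitsAll, Op.Fits]
      omega
    · simp [runAll, Op.run, hM0, hM1]
  obtain ⟨t2, s₂, e2, ht2, h0, h2, h3, h4, h6, h10⟩ := exists_exec_scan hG hW h1
  obtain ⟨s₃, e3, h3'⟩ : ∃ s₃, Exec W (block setupOps) s₂ 9 s₃ ∧
      (∀ a < blockStart g n, s₃.mem a = M a) ∧ s₃.mem (blockStart g n + n) = 0 ∧
      s₃.reg 0 = blockStart g n + n + n + 1 ∧ s₃.reg 2 = n ∧ s₃.reg 3 = m ∧ s₃.reg 4 = 1 ∧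
      s₃.reg 5 = 0 ∧ s₃.reg 6 = 2 ∧ s₃.reg 8 = blockStart g n ∧ s₃.reg 9 = blockStart g n + n ∧
      s₃.reg 10 = 0 ∧ s₃.reg 11 = n - m := by
    refine ⟨_, Exec.block ?_, fun a ha => ?_, ?_⟩
    · simp [setupOps, FitsAll, Op.run, Op.Fits, h6, h2, h4]
      omega
    · have hne : a ≠ blockStart g n + n := by omega
      simp [setupOps, runAll, Op.run, h6, h2, h0, hne]
    · simp [setupOps, runAll, Op.run, h6, h2, h3, h4, h10]
  obtain ⟨t4, s₄, e4, ht4, k1, k2, k3, k4, k5, k6, k7, k8, k9, k10, k11⟩ :=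
    exists_exec_table hG hW h3'
  obtain ⟨s₅, e5, h5⟩ : ∃ s₅, Exec W (block [.move 23 2, .move 24 0]) s₄ 3 s₅ ∧
      TraceInv n m g s₄.mem n n [] s₅ := by
    refine ⟨_, Exec.block (by simp [FitsAll, Op.Fits]),
      ⟨?_, ?_, ?_, ?_, ?_, ?_, ?_, ?_, ?_, ?_, fun a _ => rfl, holds_nil _ _⟩⟩
    all_goals simp [runAll, Op.run, k4, k5, k6, k7, k8, k9, k10, k11]
  obtain ⟨t6, s₆, b, e6, ht6, h6'⟩ := exists_exec_trace (L := L) (M := s₄.mem) k2 k3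
    (fun k hk => by
      have := blockStart_add_lt (g := g) hk
      rw [k1 _ (by omega), hG k hk])
    (fun k hk j hj => by
      have := blockStart_add_lt (g := g) hk
      have := hg k hk
      rw [k1 _ (by omega), hL k hk j hj]) hg hne hmn hW le_rfl (by simp) h5
  refine ⟨_, _, e1.seq (e2.seq (e3.seq (e4.seq (e5.seq (e6.seq (.op _ _ trivial)))))), by omega, ?_⟩
  refine output_eq_of_holds ?_ ?_
  · simpa [Op.run, h6'.reg0] using h6'.holds
  · simp [Op.run, h6'.reg0, h6'.reg24]

end Correctness
end RAM

/-! ### The encoded input in memory -/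

namespace RAM

theorem holds_getD_append (p l q : List ℕ) :
    Holds (fun a => (p ++ (l ++ q)).getD a 0) p.length l := by
  intro j hj
  beta_reduce
  rw [List.getD_eq_getElem?_getD, List.getElem?_append_right (by omega), Nat.add_sub_cancel_left,
    List.getElem?_append_left hj, List.getElem?_eq_getElem hj]
  rfl

theorem length_flatten_take {g : ℕ → ℕ} (l : List (List ℕ))
    (hg : ∀ (k : ℕ) (h : k < l.length), g k = l[k].length) {k : ℕ} (hk : k ≤ l.length) :
    ((l.take k).map fun b => b.length :: b).flatten.length + 2 = blockStart g k := by
  induction k with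
  | zero => simp [blockStart]
  | succ k ih =>
    rw [blockStart, hg k hk, ← ih (by omega), ← List.take_append_getElem hk, List.map_append,
      List.flatten_append, List.length_append]
    simp only [List.map_cons, List.map_nil, List.flatten_singleton, List.length_cons]
    omega

theorem encodeInput_eq (n m : ℕ) (L : Fin n → List ℕ) :
    encodeInput n m L = n :: m :: ((List.ofFn L).map fun b => b.length :: b).flatten := by
  rw [encodeInput, List.map_ofFn]
  rfl

variable {n : ℕ} {g : ℕ → ℕ} {L : Fin n → List ℕ}

theorem length_encodeInput (m : ℕ) (hg : ∀ i : Fin n, g i = (L i).length) :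
    (encodeInput n m L).length = blockStart g n := by
  rw [← length_flatten_take (List.ofFn L) (fun k hk => by simpa using hg ⟨k, by simpa using hk⟩) (by simp),
    encodeInput_eq, List.take_of_length_le (by simp)]
  rfl

theorem holds_encodeInput (m : ℕ) (hg : ∀ i : Fin n, g i = (L i).length) (i : Fin n) :
    Holds (fun a => (encodeInput n m L).getD a 0) (blockStart g i) (g i :: L i) := by
  have hi : (i : ℕ) < (List.ofFn L).length := by simp
  have hlen := length_flatten_take (g := g) (List.ofFn L) (fun k hk => by simpa using hg ⟨k, by simpa using hk⟩) hi.le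
  have hsplit : encodeInput n m L =
      (n :: m :: (((List.ofFn L).take i).map fun b => b.length :: b).flatten) ++
      ((g i :: L i) ++ (((List.ofFn L).drop (i + 1)).map fun b => b.length :: b).flatten) := by
    rw [encodeInput_eq]
    conv_lhs => rw [← List.take_append_drop i (List.ofFn L), List.drop_eq_getElem_cons hi]
    simp [hg]
  have := holds_getD_append (n :: m :: (((List.ofFn L).take i).map fun b => b.length :: b).flatten)
    (g i :: L i) (((List.ofFn L).drop (i + 1)).map fun b => b.length :: b).flatten
  rw [← hsplit] at this
  rwa [← hlen]

theorem exists_exec_encodeInput {m W : ℕ} {L' : ℕ → List ℕ} (hL : ∀ i : Fin n, L' i = L i)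
    (hg : ∀ i : Fin n, g i = (L i).length) (hne : ∀ i, L i ≠ []) (hmn : m < n)
    (hW : 100 * (encodeInput n m L).length ≤ W) :
    ∃ t s, Exec W grundyProg (initial (encodeInput n m L)) t s ∧
      t ≤ 100 * (encodeInput n m L).length ∧ s.output = traceSeq n m g L' n n [] := by
  rw [length_encodeInput m hg] at hW ⊢
  refine exists_exec_grundyProg (M := fun a => (encodeInput n m L).getD a 0) rfl rfl
    (fun k hk => ?_) (fun k hk j hj => ?_) (fun k hk => ?_) (fun k hk => ?_) hmn (by omega)
  · exact holds_encodeInput m hg ⟨k, hk⟩ 0 (by simp)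
  · rw [show L' k = L ⟨k, hk⟩ from hL ⟨k, hk⟩] at hj
    have := holds_encodeInput m hg ⟨k, hk⟩ (j + 1) (by simpa using hj)
    simp only [show L' k = L ⟨k, hk⟩ from hL ⟨k, hk⟩]
    rwa [add_assoc, add_comm 1 j]
  · rw [show L' k = L ⟨k, hk⟩ from hL ⟨k, hk⟩]
    exact hg ⟨k, hk⟩
  · rw [show L' k = L ⟨k, hk⟩ from hL ⟨k, hk⟩]
    exact hne ⟨k, hk⟩

end RAM

/-! ### The theorem -/

theorem mainTheorem8 :
    -- the case `n > 2 m + 2`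
    (∀ (n m : ℕ) (V : Fin n → Type u) [∀ i, Fintype (V i)] [∀ i, Nonempty (V i)]
        (R : ∀ i, SimpleGraph (V i)), 1 ≤ m → 2 * m + 2 < n →
        (((pathPower n m).xJoin R).grundyDomNumber : ℤ) =
          (pathPower n m).maxWeightIndep
            (longPathWeight n m fun i => (R i).grundyDomNumber)) ∧
    -- the case `n ≤ 2 m + 2`
    (∀ (n m : ℕ) (V : Fin n → Type u) [∀ i, Fintype (V i)] [∀ i, Nonempty (V i)]
        (R : ∀ i, SimpleGraph (V i)), 1 ≤ m → m + 2 ≤ n → n ≤ 2 * m + 2 →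
        (((pathPower n m).xJoin R).grundyDomNumber : ℤ) =
          (pathPower n m).maxWeightIndep
            (shortPathWeight n m fun i => (R i).grundyDomNumber)) ∧
    -- in both cases one fixed program turns Gds's `S i` of the graphs `R i`, whose vertices are
    -- named by words, into a Gds `T` of the product, in time linear in the length of the input
    (∃ (P : RAM.Prog) (C : ℕ), ∀ (n m : ℕ) (V : Fin n → Type u)
        [∀ i, Fintype (V i)] [∀ i, Nonempty (V i)] (R : ∀ i, SimpleGraph (V i))
        (name : (Σ i, V i) ↪ ℕ) (S : ∀ i, List (V i)) (W : ℕ),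
        1 ≤ m → m + 2 ≤ n → (∀ i, (R i).IsGds (S i)) →
        (∀ i, ∀ v ∈ S i, name ⟨i, v⟩ < W) →
        C * (encodeInput n m fun i => (S i).map fun v => name ⟨i, v⟩).length ≤ W →
        ∃ (t : ℕ) (s : RAM.State) (T : List (Σ i, V i)),
          RAM.Exec W P
            (RAM.initial (encodeInput n m fun i => (S i).map fun v => name ⟨i, v⟩)) t s ∧
          t ≤ C * (encodeInput n m fun i => (S i).map fun v => name ⟨i, v⟩).length ∧
          ((pathPower n m).xJoin R).IsGds T ∧
          s.output = T.map name) := by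
  refine ⟨fun n m V _ _ R hm hn => ?_, fun n m V _ _ R hm hn hn' => ?_,
    RAM.grundyProg, 100, fun n m V _ _ R name S W hm hn hS _ hW => ?_⟩
  · exact grundyDomNumber_xJoin_pathPower hm (by omega) (longPathWeight_eq _ hn)
  · exact grundyDomNumber_xJoin_pathPower hm (by omega) (shortPathWeight_eq _ hn hn')
  · let g : ℕ → ℕ := fun k => if h : k < n then (S ⟨k, h⟩).length else 0
    let L : ℕ → List (Σ i, V i) :=
      fun k => if h : k < n then (S ⟨k, h⟩).map (Sigma.mk _) else []
    have hg : ∀ i : Fin n, g i = (S i).length := fun i => by simp [g]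
    have hL : ∀ i : Fin n, L i = (S i).map (Sigma.mk i) := fun i => by simp [L]
    obtain ⟨t, s, he, ht, hout⟩ := RAM.exists_exec_encodeInput (g := g)
      (L' := fun k => (L k).map name) (fun i => by rw [hL i, List.map_map]; rfl)
      (fun i => by rw [hg i, List.length_map])
      (fun i => by rw [Ne, List.map_eq_nil_iff]; exact (hS i).ne_nil) (by omega) hW
    refine ⟨t, s, traceSeq n m g L n n [], he, ht, (isGds_traceSeq hm (by omega) hS hL hg).1, ?_⟩
    rw [hout, ← traceSeq_map, List.map_nil]
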